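/- Let $(M^n,g)$, $n\ge 3$, be a smooth Riemannian manifold, and let $R_{ijkl}$, $R_{ij}=g^{kl}R_{kilj}$ and $R=g^{ij}R_{ij}$ denote its curvature tensor (with sign such that $R_{ijij}>0$ for $i\neq j$ on round spheres), its Ricci tensor $Ric$ and its scalar curvature. Suppose that $(M^n,g,f,\lambda)$ is a gradient Schouten soliton, i.e. $f\in C^\infty(M)$, $\lambda\in\mathbb R$ and $$Ric+\nabla\nabla f=\Big(\frac{R}{2(n-1)}+\lambda\Big)g .$$ Define the Weyl and Cotton tensors by $$W_{ijkl}=R_{ijkl}-\frac1{n-2}\big(g_{ik}R_{jl}-g_{il}R_{jk}-g_{jk}R_{il}+g_{jl}R_{ik}\big)+\frac{R}{(n-1)(n-2)}\big(g_{ik}g_{jl}-g_{il}g_{jk}\big),$$ $$C_{ijk}=\nabla_iR_{jk}-\nabla_jR_{ik}-\frac1{2(n-1)}\big(g_{jk}\nabla_iR-g_{ik}\nabla_jR\big),$$ and the Bach tensor $B$ by $$B_{ij}=\frac1{n-3}\nabla^k\nabla^lW_{ikjl}+\frac1{n-2}R^{kl}W_{ikjl}\quad\text{if } n\ge4,\qquad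 B_{ij}=\nabla^kC_{kij}\quad\text{if } n=3 .$$ Then at every regular point $p$ of $f$ (that is, $df_p\neq0$), for all $X\in T_pM$, $$B(\nabla f,X)=\frac{R^2-(n-1)|Ric|^2}{(n-1)(n-2)^2}\,g(\nabla f,X).$$ If $n=3$ one has in addition, at every regular point $p$ of $f$ and for all $X\in T_pM$, $$(\operatorname{div}B)(X)=\frac{R^2-2|Ric|^2}{2}\,g(\nabla f,X),$$ where $(\operatorname{div}B)_j=\nabla^iB_{ij}$. -/

import Mathlib

open scoped Manifold ContDiff

/-- Smooth Riemannian metrics on a smooth `n`-manifold `M`. -/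
abbrev SmoothMetric (n : ℕ) (M : Type*) [TopologicalSpace M]
    [ChartedSpace (EuclideanSpace ℝ (Fin n)) M] [IsManifold (𝓡 n) ∞ M] : Type _ :=
  Bundle.ContMDiffRiemannianMetric (𝓡 n) ∞ (EuclideanSpace ℝ (Fin n))
    (fun x : M => TangentSpace (𝓡 n) x)

namespace Riem

/-- The components, in a coordinate chart, of a covariant tensor field of rank `k`: one function
of the coordinates for each multi-index. -/
abbrev Comp (n k : ℕ) : Type := (Fin k → Fin n) → EuclideanSpace ℝ (Fin n) → ℝ

/-- The partial derivative `∂ᵢ F` of a function of the coordinates. -/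
noncomputable def pd {n : ℕ} (i : Fin n) (F : EuclideanSpace ℝ (Fin n) → ℝ)
    (x : EuclideanSpace ℝ (Fin n)) : ℝ :=
  fderiv ℝ F x (EuclideanSpace.single i 1)

noncomputable section

variable {n : ℕ} {M : Type*} [TopologicalSpace M] [ChartedSpace (EuclideanSpace ℝ (Fin n)) M]
  [IsManifold (𝓡 n) ∞ M]

/-! ### The metric and its Levi-Civita connection in a chart `e` -/

/-- The coordinate vector field `∂ᵢ` of the chart `e`, at the point with coordinates `x`. -/
def coordField (e : OpenPartialHomeomorph M (EuclideanSpace ℝ (Fin n))) (i : Fin n)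
    (x : EuclideanSpace ℝ (Fin n)) : TangentSpace (𝓡 n) (e.symm x) :=
  mfderiv (𝓡 n) (𝓡 n) e.symm x (EuclideanSpace.single i (1 : ℝ) : EuclideanSpace ℝ (Fin n))

/-- `g_{ij} = g(∂ᵢ, ∂ⱼ)`. -/
def gLow (g : SmoothMetric n M) (e : OpenPartialHomeomorph M (EuclideanSpace ℝ (Fin n)))
    (i j : Fin n) (x : EuclideanSpace ℝ (Fin n)) : ℝ :=
  g.inner (e.symm x) (coordField e i x) (coordField e j x)

/-- `g^{ij}`, the inverse matrix of `g_{ij}`. -/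
def gUp (g : SmoothMetric n M) (e : OpenPartialHomeomorph M (EuclideanSpace ℝ (Fin n)))
    (i j : Fin n) (x : EuclideanSpace ℝ (Fin n)) : ℝ :=
  (Matrix.of fun a b => gLow g e a b x)⁻¹ i j

/-- The Christoffel symbol `Γ^k_{ij} = ½ g^{kl} (∂ᵢ g_{jl} + ∂ⱼ g_{il} - ∂ₗ g_{ij})`. -/
def christoffel (g : SmoothMetric n M) (e : OpenPartialHomeomorph M (EuclideanSpace ℝ (Fin n)))
    (k i j : Fin n) (x : EuclideanSpace ℝ (Fin n)) : ℝ :=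
  (1 / 2) * ∑ l, gUp g e k l x *
    (pd i (gLow g e j l) x + pd j (gLow g e i l) x - pd l (gLow g e i j) x)

/-- The covariant derivative of a covariant tensor, the index of differentiation coming first:
`(∇T)_{m i₁…iₖ} = ∂ₘ T_{i₁…iₖ} - ∑ₐ Γ^r_{m iₐ} T_{i₁…r…iₖ}`, with `r` in the `a`-th place. -/
def nabla (g : SmoothMetric n M) (e : OpenPartialHomeomorph M (EuclideanSpace ℝ (Fin n)))
    {k : ℕ} (T : Comp n k) : Comp n (k + 1) := fun I x =>
  pd (I 0) (T (Fin.tail I)) x -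
    ∑ a : Fin k, ∑ r, christoffel g e r (I 0) (I a.succ) x *
      T (Function.update (Fin.tail I) a r) x

/-! ### Curvature -/

/-- `R_{ijkl} = g(R(∂ᵢ, ∂ⱼ)∂ₗ, ∂ₖ)` with `R(X, Y) = ∇_X ∇_Y - ∇_Y ∇_X - ∇_{[X, Y]}`, so that
`R_{ijij} > 0` for `i ≠ j` on the round sphere and the Ricci tensor is `R_{jl} = g^{ik} R_{ijkl}`.
-/
def riemann (g : SmoothMetric n M) (e : OpenPartialHomeomorph M (EuclideanSpace ℝ (Fin n))) :
    Comp n 4 := fun I x =>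
  ∑ m, gLow g e (I 2) m x *
    (pd (I 0) (christoffel g e m (I 1) (I 3)) x - pd (I 1) (christoffel g e m (I 0) (I 3)) x +
      ∑ p, (christoffel g e m (I 0) p x * christoffel g e p (I 1) (I 3) x -
        christoffel g e m (I 1) p x * christoffel g e p (I 0) (I 3) x))

/-- The Ricci tensor `R_{jl} = g^{ik} R_{ijkl}`. -/
def ricci (g : SmoothMetric n M) (e : OpenPartialHomeomorph M (EuclideanSpace ℝ (Fin n))) :
    Comp n 2 := fun I x =>
  ∑ i, ∑ k, gUp g e i k x * riemann g e ![i, I 0, k, I 1] x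

/-- The scalar curvature `R = g^{ij} R_{ij}`. -/
def scal (g : SmoothMetric n M) (e : OpenPartialHomeomorph M (EuclideanSpace ℝ (Fin n)))
    (x : EuclideanSpace ℝ (Fin n)) : ℝ :=
  ∑ i, ∑ j, gUp g e i j x * ricci g e ![i, j] x

/-- `|Ric|² = g^{ik} g^{jl} R_{ij} R_{kl}`. -/
def ricciNormSq (g : SmoothMetric n M)
    (e : OpenPartialHomeomorph M (EuclideanSpace ℝ (Fin n))) (x : EuclideanSpace ℝ (Fin n)) : ℝ :=
  ∑ i, ∑ j, ∑ k, ∑ l, gUp g e i k x * gUp g e j l x * ricci g e ![i, j] x * ricci g e ![k, l] x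

/-- `∇R`, the differential of the scalar curvature. -/
def dScal (g : SmoothMetric n M) (e : OpenPartialHomeomorph M (EuclideanSpace ℝ (Fin n)))
    (i : Fin n) (x : EuclideanSpace ℝ (Fin n)) : ℝ :=
  pd i (scal g e) x

/-- The Weyl tensor
`W_{ijkl} = R_{ijkl} - (g_{ik} R_{jl} - g_{il} R_{jk} - g_{jk} R_{il} + g_{jl} R_{ik}) / (n-2)
  + R (g_{ik} g_{jl} - g_{il} g_{jk}) / ((n-1)(n-2))`. -/
def weyl (g : SmoothMetric n M) (e : OpenPartialHomeomorph M (EuclideanSpace ℝ (Fin n))) :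
    Comp n 4 := fun I x =>
  riemann g e I x -
    1 / ((n : ℝ) - 2) *
      (gLow g e (I 0) (I 2) x * ricci g e ![I 1, I 3] x
        - gLow g e (I 0) (I 3) x * ricci g e ![I 1, I 2] x
        - gLow g e (I 1) (I 2) x * ricci g e ![I 0, I 3] x
        + gLow g e (I 1) (I 3) x * ricci g e ![I 0, I 2] x) +
    scal g e x / (((n : ℝ) - 1) * ((n : ℝ) - 2)) *
      (gLow g e (I 0) (I 2) x * gLow g e (I 1) (I 3) x
        - gLow g e (I 0) (I 3) x * gLow g e (I 1) (I 2) x)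

/-- The Cotton tensor
`C_{ijk} = ∇ᵢ R_{jk} - ∇ⱼ R_{ik} - (g_{jk} ∇ᵢ R - g_{ik} ∇ⱼ R) / (2(n-1))`. -/
def cotton (g : SmoothMetric n M) (e : OpenPartialHomeomorph M (EuclideanSpace ℝ (Fin n))) :
    Comp n 3 := fun I x =>
  nabla g e (ricci g e) ![I 0, I 1, I 2] x - nabla g e (ricci g e) ![I 1, I 0, I 2] x -
    1 / (2 * ((n : ℝ) - 1)) *
      (gLow g e (I 1) (I 2) x * dScal g e (I 0) x - gLow g e (I 0) (I 2) x * dScal g e (I 1) x)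

/-- The Bach tensor. In dimension `n ≥ 4` it is
`B_{ij} = ∇^k ∇^l W_{ikjl} / (n-3) + R^{kl} W_{ikjl} / (n-2)`; in dimension `3` it is
`B_{ij} = ∇^k C_{kij}`. -/
def bach (g : SmoothMetric n M) (e : OpenPartialHomeomorph M (EuclideanSpace ℝ (Fin n))) :
    Comp n 2 := fun I x =>
  if n = 3 then
    ∑ k, ∑ l, gUp g e k l x * nabla g e (cotton g e) ![l, k, I 0, I 1] x
  else
    1 / ((n : ℝ) - 3) * (∑ k, ∑ l, ∑ a, ∑ b, gUp g e k a x * gUp g e l b x *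
        nabla g e (nabla g e (weyl g e)) ![a, b, I 0, k, I 1, l] x) +
      1 / ((n : ℝ) - 2) * (∑ k, ∑ l, ∑ a, ∑ b, gUp g e k a x * gUp g e l b x *
        ricci g e ![a, b] x * weyl g e ![I 0, k, I 1, l] x)

/-- The divergence `(div B)_j = ∇^i B_{ij}` of the Bach tensor. -/
def divBach (g : SmoothMetric n M) (e : OpenPartialHomeomorph M (EuclideanSpace ℝ (Fin n))) :
    Comp n 1 := fun I x =>
  ∑ i, ∑ k, gUp g e i k x * nabla g e (bach g e) ![k, i, I 0] x

/-! ### Hessian and gradient of a function -/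

/-- The Hessian `∇∇f`, the second covariant derivative of `f` regarded as a tensor of rank `0`;
`(∇∇f)_{ij} = ∂ᵢ ∂ⱼ f - Γ^r_{ij} ∂ᵣ f`. -/
def hess (g : SmoothMetric n M) (e : OpenPartialHomeomorph M (EuclideanSpace ℝ (Fin n)))
    (f : M → ℝ) : Comp n 2 :=
  nabla g e (nabla g e (k := 0) fun _ x => f (e.symm x))

/-- `g` at the point `p` as a bilinear form. -/
def metricForm (g : SmoothMetric n M) (p : M) : LinearMap.BilinForm ℝ (TangentSpace (𝓡 n) p) :=
  LinearMap.mk₂ ℝ (fun v w => g.inner p v w) (by simp) (by simp) (by simp) (by simp)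

theorem metricForm_nondegenerate (g : SmoothMetric n M) (p : M) :
    (metricForm g p).Nondegenerate := by
  have key : ∀ v : TangentSpace (𝓡 n) p, g.inner p v v = 0 → v = 0 := by
    intro v h
    by_contra hv
    exact (g.pos p v hv).ne' h
  exact ⟨fun v h => key v (h v), fun v h => key v (h v)⟩

instance (p : M) : FiniteDimensional ℝ (TangentSpace (𝓡 n) p) :=
  inferInstanceAs (FiniteDimensional ℝ (EuclideanSpace ℝ (Fin n)))

/-- The gradient of `f` at `p`: the tangent vector with `g(∇f, X) = df(X)` for all `X`. -/
def grad (g : SmoothMetric n M) (f : M → ℝ) (p : M) : TangentSpace (𝓡 n) p :=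
  ((metricForm g p).toDual (metricForm_nondegenerate g p)).symm
    (mfderiv (𝓡 n) 𝓘(ℝ, ℝ) f p : TangentSpace (𝓡 n) p →L[ℝ] ℝ).toLinearMap

theorem inner_grad (g : SmoothMetric n M) (f : M → ℝ) (p : M) (X : TangentSpace (𝓡 n) p) :
    g.inner p (grad g f p) X = mfderiv (𝓡 n) 𝓘(ℝ, ℝ) f p X :=
  LinearMap.BilinForm.apply_toDual_symm_apply (hB := metricForm_nondegenerate g p)
    (mfderiv (𝓡 n) 𝓘(ℝ, ℝ) f p : TangentSpace (𝓡 n) p →L[ℝ] ℝ).toLinearMap X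

/-! ### Evaluation of tensors on tangent vectors -/

/-- The `i`-th component `X^i` in the chart `e` of a tangent vector `X = X^i ∂ᵢ` at `p`. -/
def coord (e : OpenPartialHomeomorph M (EuclideanSpace ℝ (Fin n))) (p : M)
    (X : TangentSpace (𝓡 n) p) (i : Fin n) : ℝ :=
  let v : EuclideanSpace ℝ (Fin n) := mfderiv (𝓡 n) (𝓡 n) e p X
  v i

/-- `T(X) = T_i X^i` at the point `p`. -/
def eval₁ (e : OpenPartialHomeomorph M (EuclideanSpace ℝ (Fin n))) (T : Comp n 1) (p : M)
    (X : TangentSpace (𝓡 n) p) : ℝ :=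
  ∑ i, T ![i] (e p) * coord e p X i

/-- `T(X, Y) = T_{ij} X^i Y^j` at the point `p`. -/
def eval₂ (e : OpenPartialHomeomorph M (EuclideanSpace ℝ (Fin n))) (T : Comp n 2) (p : M)
    (X Y : TangentSpace (𝓡 n) p) : ℝ :=
  ∑ i, ∑ j, T ![i, j] (e p) * coord e p X i * coord e p Y j

/-- `(M, g, f, lam)` is a gradient Schouten soliton: `f` is smooth and
`Ric + ∇∇f = (R / (2(n-1)) + lam) g`. As always for a tensor equation, this is read in the smooth
coordinate charts. -/
def IsGradientSchoutenSoliton (g : SmoothMetric n M) (f : M → ℝ) (lam : ℝ) : Prop :=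
  ContMDiff (𝓡 n) 𝓘(ℝ, ℝ) ∞ f ∧
    ∀ e ∈ IsManifold.maximalAtlas (𝓡 n) ∞ M, ∀ x ∈ e.target, ∀ i j : Fin n,
      ricci g e ![i, j] x + hess g e f ![i, j] x =
        (scal g e x / (2 * ((n : ℝ) - 1)) + lam) * gLow g e i j x

end

end Riem

namespace Riem

noncomputable section

set_option linter.unusedSectionVars false

variable {n : ℕ} {M : Type*} [TopologicalSpace M] [ChartedSpace (EuclideanSpace ℝ (Fin n)) M]
  [IsManifold (𝓡 n) ∞ M]

/-! ### Charts and coordinate fields -/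

/-! Write `P = Ric - R/(2(n-1)) g`. The soliton equation says `∇∇f = λ g - P`, so `∇∇∇f = -∇P`. The
Cotton tensor is the antisymmetrisation of `∇P`, and the Ricci identity for `df` gives `C_{ijk} =
-R_{ijkl} ∇^l f` (`cotton_eq_tr`). Since `C` is trace-free, tracing yields `Ric(∇f) = 0`
(`tr_ricci_mul_dFun`). Everything else follows from these two identities.

In every dimension `(n-2) B_{ij} = ∇^k C_{kij} + R^{kl} W_{ikjl}` (`bach_eq`). For `n ≥ 4` this is
the divergence formula for `W`; for `n = 3` it is the definition, because `W = 0`. Contract with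
`∇f`. Differentiating `C = -Rm(∇f)` with the contracted Bianchi identity, and using `Ric(∇f) = 0`
together with its derivative, leaves only a term `Rm * Ric` in the divergence of `C`
(`tr_tr_nabla_cotton_mul_dFun`). The Riemann part of the Weyl term is its negative. What survives is
the part `g ∧ P` of `W`; since `P(∇f)` is a multiple of `df`, it is a scalar multiple of `df`
(`tr_tr_ricci_mul_weyl_mul_dFun`).

For `n = 3`, `div B` is a double divergence of `C` over two antisymmetric indices, hence half a
commutator of covariant derivatives. The Ricci identity turns it into `Rm * C` (`two_mul_divBach`).
As `W = 0`, the Cotton tensor is explicit in `df`, `Ric` and `g` (`cotton_eq_of_dim_three`), and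
substitution gives `div B = B(∇f, ·)`, so the second claim reduces to the first.

The classical background (metric compatibility, Ricci and Bianchi identities, divergence and traces
of `W`) is proved in coordinates of an arbitrary smooth chart. Contractions go through `tr`, which
commutes with `nabla` because the metric is parallel. -/

theorem chart_mdifferentiable {e : OpenPartialHomeomorph M (EuclideanSpace ℝ (Fin n))}
    (he : e ∈ IsManifold.maximalAtlas (𝓡 n) ∞ M) : e.MDifferentiable (𝓡 n) (𝓡 n) :=
  ⟨(contMDiffOn_of_mem_maximalAtlas he).mdifferentiableOn (by simp),
    (contMDiffOn_symm_of_mem_maximalAtlas he).mdifferentiableOn (by simp)⟩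

/-- The coordinate field is the tangent map of `e.symm` composed with a constant section of the
tangent bundle of the model space. Smoothness of every coordinate tensor below starts here. -/
theorem contMDiffOn_coordField {e : OpenPartialHomeomorph M (EuclideanSpace ℝ (Fin n))}
    (he : e ∈ IsManifold.maximalAtlas (𝓡 n) ∞ M) (i : Fin n) :
    ContMDiffOn (𝓡 n) (𝓡 n).tangent ∞
      (fun x => (⟨e.symm x, coordField e i x⟩ : TangentBundle (𝓡 n) M)) e.target := by
  have h := (contMDiffOn_symm_of_mem_maximalAtlas he).contMDiffOn_tangentMapWithin
    (m := ∞) (by simp) e.open_target.uniqueMDiffOn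
  have h2 : ContMDiff (𝓡 n) (𝓡 n).tangent ∞ (fun x : EuclideanSpace ℝ (Fin n) =>
      (⟨x, EuclideanSpace.single i (1 : ℝ)⟩ : TangentBundle (𝓡 n) (EuclideanSpace ℝ (Fin n)))) := by
    intro x
    refine (Bundle.contMDiffAt_section _).2 ?_
    simpa using contMDiffAt_const
  have h3 := h.comp h2.contMDiffOn (s := e.target) (fun x hx => by simpa using hx)
  refine h3.congr fun x hx => ?_
  simp [tangentMapWithin, coordField, mfderivWithin_of_isOpen e.open_target hx]

theorem contDiffOn_gLow (g : SmoothMetric n M)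
    {e : OpenPartialHomeomorph M (EuclideanSpace ℝ (Fin n))}
    (he : e ∈ IsManifold.maximalAtlas (𝓡 n) ∞ M) (i j : Fin n) :
    ContDiffOn ℝ ∞ (gLow g e i j) e.target := by
  rw [← contMDiffOn_iff_contDiffOn]
  intro x hx
  have hb : ContMDiffWithinAt (𝓡 n) (𝓡 n) ∞ e.symm e.target x :=
    contMDiffOn_symm_of_mem_maximalAtlas he x hx
  have h : ContMDiffWithinAt (𝓡 n) ((𝓡 n).prod 𝓘(ℝ)) ∞
      (fun m ↦ Bundle.TotalSpace.mk' ℝ (E := Bundle.Trivial M ℝ) (e.symm m)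
        (g.inner (e.symm m) (coordField e i m) (coordField e j m))) e.target x := by
    apply ContMDiffWithinAt.clm_bundle_apply₂ (F₁ := EuclideanSpace ℝ (Fin n))
      (F₂ := EuclideanSpace ℝ (Fin n))
    · exact ContMDiffAt.comp_contMDiffWithinAt x g.contMDiff.contMDiffAt hb
    · exact contMDiffOn_coordField he i x hx
    · exact contMDiffOn_coordField he j x hx
  simp only [Bundle.contMDiffWithinAt_totalSpace] at h
  exact h.2

theorem gLow_symm (g : SmoothMetric n M) (e : OpenPartialHomeomorph M (EuclideanSpace ℝ (Fin n)))
    (i j : Fin n) (x : EuclideanSpace ℝ (Fin n)) : gLow g e i j x = gLow g e j i x :=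
  g.symm _ _ _

theorem mfderiv_symm_eq_sum (e : OpenPartialHomeomorph M (EuclideanSpace ℝ (Fin n)))
    (x v : EuclideanSpace ℝ (Fin n)) :
    (mfderiv (𝓡 n) (𝓡 n) e.symm x v : TangentSpace (𝓡 n) (e.symm x)) =
      ∑ i, v i • coordField e i x := by
  have hv : v = ∑ i, v i • (EuclideanSpace.single i (1 : ℝ) : EuclideanSpace ℝ (Fin n)) := by
    ext j; simp [Finset.sum_apply, Pi.single_apply]
  conv_lhs => rw [hv]
  erw [map_sum]
  refine Finset.sum_congr rfl fun i _ => ?_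
  erw [map_smul]
  rfl

/-- If `v` is in the kernel, the tangent vector `X = v^i ∂ᵢ` has `g(X, X) = 0`, so `X = 0` by
positivity, and the derivative of `e.symm` is injective. -/
theorem gLow_injective (g : SmoothMetric n M)
    {e : OpenPartialHomeomorph M (EuclideanSpace ℝ (Fin n))}
    (he : e ∈ IsManifold.maximalAtlas (𝓡 n) ∞ M) {x : EuclideanSpace ℝ (Fin n)}
    (hx : x ∈ e.target) (v : Fin n → ℝ) (hv : ∀ i, ∑ j, gLow g e i j x * v j = 0) : v = 0 := by
  set X : TangentSpace (𝓡 n) (e.symm x) := mfderiv (𝓡 n) (𝓡 n) e.symm x (WithLp.toLp 2 v) with hX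
  have hXs : X = ∑ i, v i • coordField e i x := mfderiv_symm_eq_sum e x _
  have h0 : g.inner (e.symm x) X X = 0 := by
    rw [hXs, map_sum (g.inner (e.symm x)), sum_apply]
    refine Finset.sum_eq_zero fun i _ => ?_
    rw [map_smul, smul_apply, map_sum]
    have : ∑ j, g.inner (e.symm x) (coordField e i x) (v j • coordField e j x) = 0 := by
      rw [← hv i]
      refine Finset.sum_congr rfl fun j _ => ?_
      rw [map_smul, smul_eq_mul, mul_comm]; rfl
    rw [this, smul_zero]
  have hX0 : X = 0 := by
    by_contra h
    exact (g.pos _ X h).ne' h0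
  have hinj := (chart_mdifferentiable he).symm.mfderiv_injective hx
  have : (WithLp.toLp 2 v : EuclideanSpace ℝ (Fin n)) = 0 :=
    hinj (hX0.trans (map_zero (mfderiv (𝓡 n) (𝓡 n) e.symm x)).symm)
  simpa using this

theorem det_gLow_ne_zero (g : SmoothMetric n M)
    {e : OpenPartialHomeomorph M (EuclideanSpace ℝ (Fin n))}
    (he : e ∈ IsManifold.maximalAtlas (𝓡 n) ∞ M) {x : EuclideanSpace ℝ (Fin n)}
    (hx : x ∈ e.target) : (Matrix.of fun a b => gLow g e a b x).det ≠ 0 := by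
  intro h
  obtain ⟨v, hv, h0⟩ := Matrix.exists_mulVec_eq_zero_iff.mpr h
  exact hv (gLow_injective g he hx v fun i => congrFun h0 i)

theorem sum_gUp_mul_gLow (g : SmoothMetric n M)
    {e : OpenPartialHomeomorph M (EuclideanSpace ℝ (Fin n))}
    (he : e ∈ IsManifold.maximalAtlas (𝓡 n) ∞ M) {x : EuclideanSpace ℝ (Fin n)}
    (hx : x ∈ e.target) (i j : Fin n) :
    ∑ k, gUp g e i k x * gLow g e k j x = if i = j then 1 else 0 := by
  have h := Matrix.nonsing_inv_mul (Matrix.of fun a b => gLow g e a b x)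
    (det_gLow_ne_zero g he hx).isUnit
  rw [← Matrix.one_apply, ← h, Matrix.mul_apply]
  rfl

theorem gUp_symm (g : SmoothMetric n M) (e : OpenPartialHomeomorph M (EuclideanSpace ℝ (Fin n)))
    (i j : Fin n) (x : EuclideanSpace ℝ (Fin n)) : gUp g e i j x = gUp g e j i x := by
  have h : (Matrix.of fun a b => gLow g e a b x).IsSymm := by
    ext a b; exact gLow_symm g e b a x
  have := (Matrix.transpose_nonsing_inv (Matrix.of fun a b => gLow g e a b x))
  rw [h.eq] at this
  exact congrFun (congrFun this j) i

theorem contDiffOn_gUp (g : SmoothMetric n M)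
    {e : OpenPartialHomeomorph M (EuclideanSpace ℝ (Fin n))}
    (he : e ∈ IsManifold.maximalAtlas (𝓡 n) ∞ M) (i j : Fin n) :
    ContDiffOn ℝ ∞ (gUp g e i j) e.target := by
  have hdet : ∀ φ : Fin n → Fin n → EuclideanSpace ℝ (Fin n) → ℝ,
      (∀ a b, ContDiffOn ℝ ∞ (φ a b) e.target) →
      ContDiffOn ℝ ∞ (fun x => (Matrix.of fun a b => φ a b x).det) e.target := by
    intro φ hφ
    simp only [Matrix.det_apply, Matrix.of_apply]
    exact ContDiffOn.sum fun σ _ => (contDiffOn_prod fun a _ => hφ _ _).const_smul _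
  have hG := contDiffOn_gLow g he
  -- Cramer's rule: the entry is a quotient of two determinants, the numerator having row `j`
  -- replaced by a unit vector. Smoothness then reduces to that of determinants.
  have : gUp g e i j = fun x => ((Matrix.of fun a b => gLow g e a b x).det)⁻¹ *
      (Matrix.of fun a b => (Function.update (fun a b => gLow g e a b) j
        (fun b _ => (Pi.single i (1 : ℝ) : Fin n → ℝ) b)) a b x).det := by
    funext x
    rw [gUp, Matrix.inv_def, Matrix.smul_apply, Matrix.adjugate_apply, smul_eq_mul,
      Ring.inverse_eq_inv']
    congr 2
    ext a b
    by_cases h : a = j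
    · subst h; simp [Matrix.updateRow_apply]
    · simp [Matrix.updateRow_apply, h]
  rw [this]
  refine ((hdet _ hG).inv fun x hx => det_gLow_ne_zero g he hx).mul (hdet _ fun a b => ?_)
  by_cases h : a = j
  · subst h; simpa using contDiffOn_const
  · simpa [h] using hG a b

theorem symm_coord {e : OpenPartialHomeomorph M (EuclideanSpace ℝ (Fin n))}
    (he : e ∈ IsManifold.maximalAtlas (𝓡 n) ∞ M) {x : EuclideanSpace ℝ (Fin n)}
    (hx : x ∈ e.target) (X : TangentSpace (𝓡 n) (e.symm x)) :
    X = ∑ i, coord e (e.symm x) X i • coordField e i x := by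
  obtain ⟨v, rfl⟩ : ∃ v : EuclideanSpace ℝ (Fin n),
      X = (mfderiv (𝓡 n) (𝓡 n) e.symm x v : TangentSpace (𝓡 n) (e.symm x)) :=
    ((chart_mdifferentiable he).symm.mfderiv_surjective hx X).imp fun _ h => h.symm
  have h := congrFun (congrArg DFunLike.coe ((chart_mdifferentiable he).comp_symm_deriv hx)) v
  have hv : ∀ i, coord e (e.symm x) (mfderiv (𝓡 n) (𝓡 n) e.symm x v) i = v i :=
    fun i => congrArg (fun w : EuclideanSpace ℝ (Fin n) => w i) h
  simp only [hv]
  exact mfderiv_symm_eq_sum e x v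

theorem mfderiv_coordField {e : OpenPartialHomeomorph M (EuclideanSpace ℝ (Fin n))}
    (he : e ∈ IsManifold.maximalAtlas (𝓡 n) ∞ M) {x : EuclideanSpace ℝ (Fin n)}
    (hx : x ∈ e.target) {f : M → ℝ} (hf : ContMDiff (𝓡 n) 𝓘(ℝ, ℝ) ∞ f) (i : Fin n) :
    (mfderiv (𝓡 n) 𝓘(ℝ, ℝ) f (e.symm x) (coordField e i x) : ℝ) =
      pd i (fun y => f (e.symm y)) x := by
  have h := mfderiv_comp x (hf.mdifferentiableAt (by simp) (x := e.symm x))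
    ((chart_mdifferentiable he).mdifferentiableAt_symm hx)
  rw [mfderiv_eq_fderiv] at h
  exact (congrFun (congrArg DFunLike.coe h) (EuclideanSpace.single i (1 : ℝ))).symm

theorem contDiffOn_comp_symm {e : OpenPartialHomeomorph M (EuclideanSpace ℝ (Fin n))}
    (he : e ∈ IsManifold.maximalAtlas (𝓡 n) ∞ M) {f : M → ℝ}
    (hf : ContMDiff (𝓡 n) 𝓘(ℝ, ℝ) ∞ f) :
    ContDiffOn ℝ ∞ (fun y => f (e.symm y)) e.target := by
  rw [← contMDiffOn_iff_contDiffOn]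
  exact hf.comp_contMDiffOn (contMDiffOn_symm_of_mem_maximalAtlas he)

theorem mfderiv_eq_sum {e : OpenPartialHomeomorph M (EuclideanSpace ℝ (Fin n))}
    (he : e ∈ IsManifold.maximalAtlas (𝓡 n) ∞ M) {x : EuclideanSpace ℝ (Fin n)}
    (hx : x ∈ e.target) {f : M → ℝ} (hf : ContMDiff (𝓡 n) 𝓘(ℝ, ℝ) ∞ f)
    (X : TangentSpace (𝓡 n) (e.symm x)) :
    (mfderiv (𝓡 n) 𝓘(ℝ, ℝ) f (e.symm x) X : ℝ) =
      ∑ i, coord e (e.symm x) X i * pd i (fun y => f (e.symm y)) x := by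
  conv_lhs => rw [symm_coord he hx X]
  erw [map_sum]
  refine Finset.sum_congr rfl fun i _ => ?_
  rw [← mfderiv_coordField he hx hf i]
  erw [map_smul]
  rfl

/-! ### Partial derivatives -/

section PartialDerivatives

variable {F G : EuclideanSpace ℝ (Fin n) → ℝ} {s : Set (EuclideanSpace ℝ (Fin n))}
  {x : EuclideanSpace ℝ (Fin n)}

theorem _root_.ContDiffOn.diffAt (hF : ContDiffOn ℝ ∞ F s) (hs : IsOpen s) (hx : x ∈ s) :
    DifferentiableAt ℝ F x :=
  (hF.contDiffAt (hs.mem_nhds hx)).differentiableAt (by simp)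

theorem contDiffOn_pd (hs : IsOpen s) (hF : ContDiffOn ℝ ∞ F s) (i : Fin n) :
    ContDiffOn ℝ ∞ (pd i F) s :=
  (hF.fderiv_of_isOpen hs (m := ∞) (by simp)).clm_apply contDiffOn_const

theorem pd_add (i : Fin n) (hF : DifferentiableAt ℝ F x) (hG : DifferentiableAt ℝ G x) :
    pd i (fun y => F y + G y) x = pd i F x + pd i G x := by
  simp [pd, fderiv_fun_add hF hG]

theorem pd_sub (i : Fin n) (hF : DifferentiableAt ℝ F x) (hG : DifferentiableAt ℝ G x) :
    pd i (fun y => F y - G y) x = pd i F x - pd i G x := by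
  simp [pd, fderiv_fun_sub hF hG]

theorem pd_mul (i : Fin n) (hF : DifferentiableAt ℝ F x) (hG : DifferentiableAt ℝ G x) :
    pd i (fun y => F y * G y) x = pd i F x * G x + F x * pd i G x := by
  simp [pd, fderiv_fun_mul hF hG]; ring

theorem pd_const (i : Fin n) (c : ℝ) (x : EuclideanSpace ℝ (Fin n)) :
    pd i (fun _ => c) x = 0 := by
  simp [pd]

theorem pd_sum {ι : Type*} (u : Finset ι) {F : ι → EuclideanSpace ℝ (Fin n) → ℝ} (i : Fin n)
    (hF : ∀ a ∈ u, DifferentiableAt ℝ (F a) x) :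
    pd i (fun y => ∑ a ∈ u, F a y) x = ∑ a ∈ u, pd i (F a) x := by
  simp [pd, fderiv_fun_sum hF, sum_apply]

theorem pd_congr (hs : IsOpen s) (hx : x ∈ s) (h : ∀ y ∈ s, F y = G y) (i : Fin n) :
    pd i F x = pd i G x := by
  rw [pd, pd, Filter.EventuallyEq.fderiv_eq (Filter.eventually_of_mem (hs.mem_nhds hx) h)]

theorem pd_comm (hs : IsOpen s) (hF : ContDiffOn ℝ ∞ F s) (hx : x ∈ s) (i j : Fin n) :
    pd i (pd j F) x = pd j (pd i F) x := by
  have hF' := hF.contDiffAt (hs.mem_nhds hx)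
  have hsymm : IsSymmSndFDerivAt ℝ F x := hF'.isSymmSndFDerivAt (by
    simpa using WithTop.coe_le_coe.2 (le_top (a := (2 : ℕ∞))))
  have hd : DifferentiableAt ℝ (fderiv ℝ F) x :=
    (hF'.fderiv_right (m := ∞) (by simp)).differentiableAt (by simp)
  have key : ∀ v w : EuclideanSpace ℝ (Fin n),
      fderiv ℝ (fun y => fderiv ℝ F y w) x v = fderiv ℝ (fderiv ℝ F) x v w := by
    intro v w
    rw [fderiv_clm_apply hd (differentiableAt_const w)]
    simp
  exact (key _ _).trans ((hsymm _ _).trans (key _ _).symm)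

end PartialDerivatives

/-! ### Christoffel symbols and the inverse metric -/

section Chart

variable (g : SmoothMetric n M) {e : OpenPartialHomeomorph M (EuclideanSpace ℝ (Fin n))}
  (he : e ∈ IsManifold.maximalAtlas (𝓡 n) ∞ M) {x : EuclideanSpace ℝ (Fin n)} (hx : x ∈ e.target)

theorem christoffel_symm (g : SmoothMetric n M)
    (e : OpenPartialHomeomorph M (EuclideanSpace ℝ (Fin n))) (k i j : Fin n)
    (x : EuclideanSpace ℝ (Fin n)) : christoffel g e k i j x = christoffel g e k j i x := by
  have h : gLow g e i j = gLow g e j i := funext fun y => gLow_symm g e i j y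
  simp only [christoffel, h]
  congr 1
  exact Finset.sum_congr rfl fun l _ => by ring

include he

theorem contDiffOn_christoffel (k i j : Fin n) :
    ContDiffOn ℝ ∞ (christoffel g e k i j) e.target := by
  have h : ∀ a b c : Fin n, ContDiffOn ℝ ∞ (pd a (gLow g e b c)) e.target := fun a b c =>
    contDiffOn_pd e.open_target (contDiffOn_gLow g he b c) a
  exact contDiffOn_const.mul (ContDiffOn.sum fun l _ =>
    (contDiffOn_gUp g he k l).mul (((h _ _ _).add (h _ _ _)).sub (h _ _ _)))

theorem contDiffOn_nabla {k : ℕ} {T : Comp n k} (hT : ∀ I, ContDiffOn ℝ ∞ (T I) e.target)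
    (I : Fin (k + 1) → Fin n) : ContDiffOn ℝ ∞ (nabla g e T I) e.target :=
  (contDiffOn_pd e.open_target (hT _) _).sub (ContDiffOn.sum fun _ _ => ContDiffOn.sum fun _ _ =>
    (contDiffOn_christoffel g he _ _ _).mul (hT _))

include hx

theorem sum_gLow_mul_gUp (i j : Fin n) :
    ∑ k, gLow g e i k x * gUp g e k j x = if i = j then 1 else 0 := by
  rw [show (if i = j then (1 : ℝ) else 0) = if j = i then 1 else 0 by simp [eq_comm],
    ← sum_gUp_mul_gLow g he hx j i]
  refine Finset.sum_congr rfl fun k _ => ?_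
  rw [gUp_symm g e j k, gLow_symm g e k i, mul_comm]

/-- Lowering the upper index cancels the inverse metric in the definition of the Christoffel symbol.
-/
theorem sum_gLow_mul_christoffel (s i j : Fin n) :
    ∑ k, gLow g e s k x * christoffel g e k i j x =
      1 / 2 * (pd i (gLow g e j s) x + pd j (gLow g e i s) x - pd s (gLow g e i j) x) := by
  have h : ∀ φ : Fin n → ℝ, ∑ k, gLow g e s k x * (1 / 2 * ∑ l, gUp g e k l x * φ l) =
      1 / 2 * φ s := by
    intro φ
    simp only [Finset.mul_sum]
    rw [Finset.sum_comm]
    have : ∀ l, ∑ k, gLow g e s k x * (1 / 2 * (gUp g e k l x * φ l)) =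
        (if s = l then 1 else 0) * (1 / 2 * φ l) := by
      intro l
      rw [← sum_gLow_mul_gUp g he hx s l, Finset.sum_mul]
      exact Finset.sum_congr rfl fun k _ => by ring
    rw [Finset.sum_congr rfl fun l _ => this l]
    simp
  exact h _

/-- This is metric compatibility `∇g = 0`: adding the two lowered Christoffel symbols makes all but
one of the derivatives of `g` cancel. -/
theorem pd_gLow (m i j : Fin n) :
    pd m (gLow g e i j) x = ∑ r, christoffel g e r m i x * gLow g e r j x +
      ∑ r, christoffel g e r m j x * gLow g e i r x := by
  have h1 : ∑ r, christoffel g e r m i x * gLow g e r j x =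
      ∑ r, gLow g e j r x * christoffel g e r m i x :=
    Finset.sum_congr rfl fun r _ => by rw [gLow_symm g e r j, mul_comm]
  have h2 : ∑ r, christoffel g e r m j x * gLow g e i r x =
      ∑ r, gLow g e i r x * christoffel g e r m j x :=
    Finset.sum_congr rfl fun r _ => mul_comm _ _
  have h : ∀ a b, gLow g e a b = gLow g e b a := fun a b => funext fun y => gLow_symm g e a b y
  rw [h1, h2, sum_gLow_mul_christoffel g he hx, sum_gLow_mul_christoffel g he hx, h j i, h m i,
    h m j]
  ring

/-- Differentiate `g⁻¹ g = 1`, multiply by `g⁻¹` on the right, and insert `pd_gLow`: the inverse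
metric is parallel too. -/
theorem pd_gUp (m k l : Fin n) :
    pd m (gUp g e k l) x = -∑ r, christoffel g e k m r x * gUp g e r l x -
      ∑ r, christoffel g e l m r x * gUp g e k r x := by
  have hU : ∀ a b, DifferentiableAt ℝ (gUp g e a b) x := fun a b =>
    (contDiffOn_gUp g he a b).diffAt e.open_target hx
  have hL : ∀ a b, DifferentiableAt ℝ (gLow g e a b) x := fun a b =>
    (contDiffOn_gLow g he a b).diffAt e.open_target hx
  have h0 : ∀ b, ∑ a, pd m (gUp g e k a) x * gLow g e a b x +
      ∑ a, gUp g e k a x * pd m (gLow g e a b) x = 0 := by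
    intro b
    rw [← pd_const m (if k = b then (1 : ℝ) else 0) x,
      ← pd_congr e.open_target hx (fun y hy => sum_gUp_mul_gLow g he hy k b) m,
      pd_sum _ _ fun a _ => (hU k a).fun_mul (hL a b), ← Finset.sum_add_distrib]
    exact Finset.sum_congr rfl fun a _ => (pd_mul m (hU k a) (hL a b)).symm
  have h1 : pd m (gUp g e k l) x =
      ∑ b, (∑ a, pd m (gUp g e k a) x * gLow g e a b x) * gUp g e b l x := by
    simp only [Finset.sum_mul]
    rw [Finset.sum_comm]
    simp only [mul_assoc, ← Finset.mul_sum, sum_gLow_mul_gUp g he hx]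
    simp
  have h2 : ∀ b, ∑ a, pd m (gUp g e k a) x * gLow g e a b x =
      -(∑ r, (∑ a, gUp g e k a x * christoffel g e r m a x) * gLow g e r b x) -
        christoffel g e k m b x := by
    intro b
    rw [eq_neg_of_add_eq_zero_left (h0 b)]
    simp only [pd_gLow g he hx, mul_add, Finset.sum_add_distrib, Finset.mul_sum, Finset.sum_mul]
    have h3 : ∑ a, ∑ r, gUp g e k a x * (christoffel g e r m b x * gLow g e a r x) =
        christoffel g e k m b x := by
      rw [Finset.sum_comm]
      have : ∀ r, ∑ a, gUp g e k a x * (christoffel g e r m b x * gLow g e a r x) =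
          (if k = r then 1 else 0) * christoffel g e r m b x := by
        intro r
        rw [← sum_gUp_mul_gLow g he hx k r, Finset.sum_mul]
        exact Finset.sum_congr rfl fun a _ => by ring
      rw [Finset.sum_congr rfl fun r _ => this r]
      simp
    rw [h3, Finset.sum_comm]
    simp only [mul_assoc]
    ring
  have h4 : ∑ b, (∑ r, (∑ a, gUp g e k a x * christoffel g e r m a x) * gLow g e r b x) *
      gUp g e b l x = ∑ r, christoffel g e l m r x * gUp g e k r x := by
    simp only [Finset.sum_mul (s := Finset.univ) (f := fun r =>
      (∑ a, gUp g e k a x * christoffel g e r m a x) * gLow g e r _ x)]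
    rw [Finset.sum_comm]
    simp only [mul_assoc, ← Finset.mul_sum, sum_gLow_mul_gUp g he hx]
    simp [mul_comm]
  rw [h1, Finset.sum_congr rfl fun b _ => by rw [h2 b]]
  simp only [sub_mul, neg_mul, Finset.sum_sub_distrib, Finset.sum_neg_distrib, h4]
  ring

/-- The derivative of the inverse metric contributes exactly the Christoffel corrections of the two
contracted slots, after relabelling indices. Hence traces commute with covariant differentiation. -/
theorem pd_trace {φ : Fin n → Fin n → EuclideanSpace ℝ (Fin n) → ℝ}
    (hφ : ∀ k l, DifferentiableAt ℝ (φ k l) x) (m : Fin n) :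
    pd m (fun y => ∑ k, ∑ l, gUp g e k l y * φ k l y) x =
      ∑ k, ∑ l, gUp g e k l x * (pd m (φ k l) x - ∑ r, christoffel g e r m k x * φ r l x -
        ∑ r, christoffel g e r m l x * φ k r x) := by
  have hU : ∀ a b, DifferentiableAt ℝ (gUp g e a b) x := fun a b =>
    (contDiffOn_gUp g he a b).diffAt e.open_target hx
  rw [pd_sum _ _ fun k _ => DifferentiableAt.fun_sum fun l _ => (hU k l).fun_mul (hφ k l)]
  have h : ∀ k, pd m (fun y => ∑ l, gUp g e k l y * φ k l y) x =
      ∑ l, ((-∑ r, christoffel g e k m r x * gUp g e r l x -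
        ∑ r, christoffel g e l m r x * gUp g e k r x) * φ k l x + gUp g e k l x * pd m (φ k l) x) := by
    intro k
    rw [pd_sum _ _ fun l _ => (hU k l).fun_mul (hφ k l)]
    refine Finset.sum_congr rfl fun l _ => ?_
    rw [← pd_gUp g he hx]
    exact pd_mul m (hU k l) (hφ k l)
  simp only [h, mul_sub, sub_mul, neg_mul, Finset.sum_add_distrib, Finset.sum_sub_distrib,
    Finset.sum_neg_distrib, Finset.sum_mul, Finset.mul_sum]
  have e1 : ∑ k, ∑ l, ∑ r, christoffel g e k m r x * gUp g e r l x * φ k l x =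
      ∑ k, ∑ l, ∑ r, gUp g e k l x * (christoffel g e r m k x * φ r l x) := by
    calc _ = ∑ k, ∑ r, ∑ l, christoffel g e k m r x * gUp g e r l x * φ k l x :=
          Finset.sum_congr rfl fun k _ => Finset.sum_comm
      _ = ∑ r, ∑ k, ∑ l, christoffel g e k m r x * gUp g e r l x * φ k l x := Finset.sum_comm
      _ = ∑ r, ∑ l, ∑ k, christoffel g e k m r x * gUp g e r l x * φ k l x :=
          Finset.sum_congr rfl fun k _ => Finset.sum_comm
      _ = _ := Finset.sum_congr rfl fun r _ => Finset.sum_congr rfl fun l _ =>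
          Finset.sum_congr rfl fun k _ => by ring
  have e2 : ∑ k, ∑ l, ∑ r, christoffel g e l m r x * gUp g e k r x * φ k l x =
      ∑ k, ∑ l, ∑ r, gUp g e k l x * (christoffel g e r m l x * φ k r x) := by
    refine Finset.sum_congr rfl fun k _ => ?_
    rw [Finset.sum_comm]
    exact Finset.sum_congr rfl fun r _ => Finset.sum_congr rfl fun l _ => by ring
  rw [e1, e2]
  ring

end Chart

/-! ### The Ricci identity -/

/-- The curvature with its third index raised: `[∇_a, ∇_b] ∂_l = R^m_{l, ab} ∂_m`. -/
def curv (g : SmoothMetric n M) (e : OpenPartialHomeomorph M (EuclideanSpace ℝ (Fin n)))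
    (m a b l : Fin n) (x : EuclideanSpace ℝ (Fin n)) : ℝ :=
  pd a (christoffel g e m b l) x - pd b (christoffel g e m a l) x +
    ∑ p, (christoffel g e m a p x * christoffel g e p b l x -
      christoffel g e m b p x * christoffel g e p a l x)

theorem nabla_cons (g : SmoothMetric n M) (e : OpenPartialHomeomorph M (EuclideanSpace ℝ (Fin n)))
    {k : ℕ} (T : Comp n k) (a : Fin n) (J : Fin k → Fin n) (x : EuclideanSpace ℝ (Fin n)) :
    nabla g e T (Fin.cons a J) x = pd a (T J) x -
      ∑ s : Fin k, ∑ r, christoffel g e r a (J s) x * T (Function.update J s r) x := by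
  simp [nabla]

/-- The terms are grouped by their behaviour under exchange of `a` and `b`. The second partials, the
mixed `Γ ∂T` terms and the term in `Γ^r_{ab}` are symmetric; the other two groups produce curvature.
-/
theorem nabla_nabla_cons_cons (g : SmoothMetric n M)
    {e : OpenPartialHomeomorph M (EuclideanSpace ℝ (Fin n))}
    (he : e ∈ IsManifold.maximalAtlas (𝓡 n) ∞ M) {x : EuclideanSpace ℝ (Fin n)}
    (hx : x ∈ e.target) {k : ℕ} {T : Comp n k} (hT : ∀ I, ContDiffOn ℝ ∞ (T I) e.target)
    (a b : Fin n) (J : Fin k → Fin n) :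
    nabla g e (nabla g e T) (Fin.cons a (Fin.cons b J)) x =
      pd a (pd b (T J)) x -
      (∑ s : Fin k, ∑ r, pd a (christoffel g e r b (J s)) x * T (Function.update J s r) x) -
      (∑ s : Fin k, ∑ r, (christoffel g e r b (J s) x * pd a (T (Function.update J s r)) x +
        christoffel g e r a (J s) x * pd b (T (Function.update J s r)) x)) -
      (∑ r, christoffel g e r a b x * nabla g e T (Fin.cons r J) x) +
      ∑ s : Fin k, ∑ r, christoffel g e r a (J s) x * ∑ t : Fin k, ∑ q,
        christoffel g e q b (Function.update J s r t) x *
          T (Function.update (Function.update J s r) t q) x := by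
  have hΓ : ∀ p q r, DifferentiableAt ℝ (christoffel g e p q r) x := fun p q r =>
    (contDiffOn_christoffel g he p q r).diffAt e.open_target hx
  have hTx : ∀ I, DifferentiableAt ℝ (T I) x := fun I => (hT I).diffAt e.open_target hx
  have h1 : pd a (nabla g e T (Fin.cons b J)) x = pd a (pd b (T J)) x -
      ∑ s : Fin k, ∑ r, (pd a (christoffel g e r b (J s)) x * T (Function.update J s r) x +
        christoffel g e r b (J s) x * pd a (T (Function.update J s r)) x) := by
    rw [show nabla g e T (Fin.cons b J) = fun y => _ from funext fun y => nabla_cons g e T b J y,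
      pd_sub _ ((contDiffOn_pd e.open_target (hT J) b).diffAt e.open_target hx)
      (DifferentiableAt.fun_sum fun s _ => DifferentiableAt.fun_sum fun r _ => (hΓ _ _ _).fun_mul (hTx _)),
      pd_sum _ _ fun s _ => DifferentiableAt.fun_sum fun r _ => (hΓ _ _ _).fun_mul (hTx _)]
    congr 1
    refine Finset.sum_congr rfl fun s _ => ?_
    rw [pd_sum _ _ fun r _ => (hΓ _ _ _).fun_mul (hTx _)]
    exact Finset.sum_congr rfl fun r _ => pd_mul a (hΓ _ _ _) (hTx _)
  -- Slot `0` of `nabla g e T` is the inner derivative index `b`; its correction is split from those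
  -- of the slots of `T`.
  rw [nabla_cons, h1, Fin.sum_univ_succ]
  simp only [Fin.cons_zero, Fin.cons_succ, Fin.update_cons_zero, ← Fin.cons_update]
  simp only [nabla_cons, mul_sub, Finset.sum_add_distrib, Finset.sum_sub_distrib]
  ring

/-- In the commutator the symmetric groups cancel, by equality of mixed partials and vanishing
torsion. The remaining `∂Γ` and `ΓΓ` terms acting in a single slot assemble to `curv`. -/
theorem ricci_identity (g : SmoothMetric n M)
    {e : OpenPartialHomeomorph M (EuclideanSpace ℝ (Fin n))}
    (he : e ∈ IsManifold.maximalAtlas (𝓡 n) ∞ M) {x : EuclideanSpace ℝ (Fin n)}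
    (hx : x ∈ e.target) {k : ℕ} {T : Comp n k} (hT : ∀ I, ContDiffOn ℝ ∞ (T I) e.target)
    (a b : Fin n) (J : Fin k → Fin n) :
    nabla g e (nabla g e T) (Fin.cons a (Fin.cons b J)) x -
      nabla g e (nabla g e T) (Fin.cons b (Fin.cons a J)) x =
      -∑ s : Fin k, ∑ r, curv g e r a b (J s) x * T (Function.update J s r) x := by
  rw [nabla_nabla_cons_cons g he hx hT, nabla_nabla_cons_cons g he hx hT]
  -- Separate the two corrections hitting the same slot (`t = s`), which form a product of
  -- connection matrices, from those hitting different slots.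
  have split : ∀ a b : Fin n, (∑ s : Fin k, ∑ r, christoffel g e r a (J s) x * ∑ t : Fin k, ∑ q,
        christoffel g e q b (Function.update J s r t) x *
          T (Function.update (Function.update J s r) t q) x) =
      (∑ s : Fin k, ∑ r, ∑ q, christoffel g e r a (J s) x * christoffel g e q b r x *
        T (Function.update J s q) x) +
      ∑ s : Fin k, ∑ t : Fin k, ∑ r, ∑ q, if t = s then 0 else
        christoffel g e r a (J s) x * christoffel g e q b (J t) x *
          T (Function.update (Function.update J s r) t q) x := by
    intro a b
    rw [← Finset.sum_add_distrib]
    refine Finset.sum_congr rfl fun s _ => ?_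
    rw [Finset.sum_comm (f := fun (t : Fin k) r => ∑ q, if t = s then 0 else
        christoffel g e r a (J s) x * christoffel g e q b (J t) x *
          T (Function.update (Function.update J s r) t q) x), ← Finset.sum_add_distrib]
    refine Finset.sum_congr rfl fun r _ => ?_
    rw [← Finset.add_sum_erase _ _ (Finset.mem_univ s), ← Finset.add_sum_erase _ (fun t => ∑ q,
      if t = s then (0 : ℝ) else christoffel g e r a (J s) x * christoffel g e q b (J t) x *
          T (Function.update (Function.update J s r) t q) x) (Finset.mem_univ s), mul_add]
    simp only [Function.update_self, Function.update_idem, if_true, Finset.sum_const_zero, zero_add]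
    congr 1
    · rw [Finset.mul_sum]
      exact Finset.sum_congr rfl fun q _ => by ring
    · rw [Finset.mul_sum]
      refine Finset.sum_congr rfl fun t ht => ?_
      rw [Finset.mul_sum]
      refine Finset.sum_congr rfl fun q _ => ?_
      rw [if_neg (Finset.ne_of_mem_erase ht), Function.update_of_ne (Finset.ne_of_mem_erase ht)]
      ring
  -- Corrections in different slots commute, so this part is symmetric in `a` and `b`.
  have swap : (∑ s : Fin k, ∑ t : Fin k, ∑ r, ∑ q, if t = s then 0 else
        christoffel g e r a (J s) x * christoffel g e q b (J t) x *
          T (Function.update (Function.update J s r) t q) x) =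
      ∑ s : Fin k, ∑ t : Fin k, ∑ r, ∑ q, if t = s then 0 else
        christoffel g e r b (J s) x * christoffel g e q a (J t) x *
          T (Function.update (Function.update J s r) t q) x := by
    rw [Finset.sum_comm]
    refine Finset.sum_congr rfl fun s _ => Finset.sum_congr rfl fun t _ => ?_
    rw [Finset.sum_comm]
    refine Finset.sum_congr rfl fun r _ => Finset.sum_congr rfl fun q _ => ?_
    by_cases h : t = s
    · simp [h]
    · rw [if_neg h, if_neg (Ne.symm h), Function.update_comm h]
      ring
  have hcurv : (∑ s : Fin k, ∑ r, curv g e r a b (J s) x * T (Function.update J s r) x) =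
      (∑ s : Fin k, ∑ r, pd a (christoffel g e r b (J s)) x * T (Function.update J s r) x) -
      (∑ s : Fin k, ∑ r, pd b (christoffel g e r a (J s)) x * T (Function.update J s r) x) +
      (∑ s : Fin k, ∑ r, ∑ q, christoffel g e r b (J s) x * christoffel g e q a r x *
        T (Function.update J s q) x) -
      ∑ s : Fin k, ∑ r, ∑ q, christoffel g e r a (J s) x * christoffel g e q b r x *
        T (Function.update J s q) x := by
    have h : ∀ s : Fin k, ∀ a b : Fin n, (∑ r, ∑ q, christoffel g e r b (J s) x *
        christoffel g e q a r x * T (Function.update J s q) x) = ∑ r, ∑ q,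
        christoffel g e r a q x * christoffel g e q b (J s) x * T (Function.update J s r) x := by
      intro s a b
      rw [Finset.sum_comm]
      exact Finset.sum_congr rfl fun r _ => Finset.sum_congr rfl fun q _ => by ring
    simp only [h, curv, add_mul, sub_mul, Finset.sum_mul, Finset.sum_add_distrib,
      Finset.sum_sub_distrib]
    ring
  rw [split, split, swap, hcurv, pd_comm e.open_target (hT J) hx a b]
  have hs : ∑ r, christoffel g e r a b x * nabla g e T (Fin.cons r J) x =
      ∑ r, christoffel g e r b a x * nabla g e T (Fin.cons r J) x :=
    Finset.sum_congr rfl fun r _ => by rw [christoffel_symm]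
  rw [hs]
  simp only [Finset.sum_add_distrib]
  ring

/-! ### Metric traces -/

/-- The metric trace `g^{kl} φ_{kl}` at the point with coordinates `x`. -/
def tr (g : SmoothMetric n M) (e : OpenPartialHomeomorph M (EuclideanSpace ℝ (Fin n)))
    (x : EuclideanSpace ℝ (Fin n)) (φ : Fin n → Fin n → ℝ) : ℝ :=
  ∑ k, ∑ l, gUp g e k l x * φ k l

section Trace

variable (g : SmoothMetric n M) (e : OpenPartialHomeomorph M (EuclideanSpace ℝ (Fin n)))
  (x : EuclideanSpace ℝ (Fin n)) (φ ψ : Fin n → Fin n → ℝ)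

theorem tr_add : tr g e x (fun k l => φ k l + ψ k l) = tr g e x φ + tr g e x ψ := by
  simp only [tr, mul_add, Finset.sum_add_distrib]

theorem tr_sub : tr g e x (fun k l => φ k l - ψ k l) = tr g e x φ - tr g e x ψ := by
  simp only [tr, mul_sub, Finset.sum_sub_distrib]

theorem tr_neg : tr g e x (fun k l => -φ k l) = -tr g e x φ := by
  simp only [tr, mul_neg, Finset.sum_neg_distrib]

theorem tr_zero : tr g e x (fun _ _ => 0) = 0 := by
  simp [tr]

theorem tr_const_mul (c : ℝ) : tr g e x (fun k l => c * φ k l) = c * tr g e x φ := by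
  simp only [tr, Finset.mul_sum, mul_left_comm c]

theorem tr_mul_const (c : ℝ) : tr g e x (fun k l => φ k l * c) = tr g e x φ * c := by
  simp only [tr, Finset.sum_mul, mul_assoc]

theorem tr_transpose : tr g e x φ = tr g e x fun k l => φ l k := by
  rw [tr, Finset.sum_comm]
  exact Finset.sum_congr rfl fun k _ => Finset.sum_congr rfl fun l _ => by rw [gUp_symm]

theorem tr_congr {φ ψ : Fin n → Fin n → ℝ} (h : ∀ k l, φ k l = ψ k l) :
    tr g e x φ = tr g e x ψ := by
  rw [show φ = ψ from funext fun k => funext fun l => h k l]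

theorem tr_comm (χ : Fin n → Fin n → Fin n → Fin n → ℝ) :
    tr g e x (fun k l => tr g e x fun a b => χ k l a b) =
      tr g e x fun a b => tr g e x fun k l => χ k l a b := by
  have h : ∀ χ : Fin n → Fin n → Fin n → Fin n → ℝ,
      tr g e x (fun k l => tr g e x fun a b => χ k l a b) =
        ∑ p : Fin n × Fin n, ∑ q : Fin n × Fin n,
          gUp g e p.1 p.2 x * gUp g e q.1 q.2 x * χ p.1 p.2 q.1 q.2 := by
    intro χ
    simp only [tr, Fintype.sum_prod_type, Finset.mul_sum, mul_assoc]
  rw [h, h, Finset.sum_comm]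
  exact Finset.sum_congr rfl fun p _ => Finset.sum_congr rfl fun q _ => by ring

/-- Moves a Christoffel sum over a free index inside a trace, so that the corrections of a
contracted tensor can be compared term by term. -/
theorem sum_mul_tr (c : Fin n → ℝ) (χ : Fin n → Fin n → Fin n → ℝ) :
    ∑ r, c r * tr g e x (χ r) = tr g e x fun k l => ∑ r, c r * χ r k l := by
  simp only [tr, Finset.mul_sum]
  rw [Finset.sum_comm]
  refine Finset.sum_congr rfl fun k _ => ?_
  rw [Finset.sum_comm]
  exact Finset.sum_congr rfl fun l _ => Finset.sum_congr rfl fun r _ => by ring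

/-- The trace of a symmetric against an antisymmetric tensor vanishes. -/
theorem tr_tr_symm_mul_antisymm (hφ : ∀ i j, φ i j = φ j i) (hψ : ∀ i j, ψ i j = -ψ j i) :
    tr g e x (fun k l => tr g e x fun a b => φ k a * ψ l b) = 0 := by
  have h : tr g e x (fun k l => tr g e x fun a b => φ k a * ψ l b) =
      -tr g e x (fun k l => tr g e x fun a b => φ k a * ψ l b) := by
    conv_lhs => rw [tr_comm]
    rw [← tr_neg]
    refine tr_congr g e x fun k l => ?_
    rw [← tr_neg]
    refine tr_congr g e x fun a b => ?_
    rw [hφ a k, hψ b l]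
    ring
  linarith

variable {e} {x}
variable (he : e ∈ IsManifold.maximalAtlas (𝓡 n) ∞ M) (hx : x ∈ e.target)
include he hx

theorem tr_gLow_mul (i : Fin n) (v : Fin n → ℝ) :
    tr g e x (fun k l => gLow g e i k x * v l) = v i := by
  simp only [tr]
  rw [Finset.sum_comm]
  have : ∀ l, ∑ k, gUp g e k l x * (gLow g e i k x * v l) = (if i = l then 1 else 0) * v l := by
    intro l
    rw [← sum_gLow_mul_gUp g he hx i l, Finset.sum_mul]
    exact Finset.sum_congr rfl fun k _ => by ring
  rw [Finset.sum_congr rfl fun l _ => this l]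
  simp

theorem tr_gLow : tr g e x (fun k l => gLow g e k l x) = n := by
  have h : ∀ k, ∑ l, gUp g e k l x * gLow g e k l x = 1 := by
    intro k
    rw [← if_pos (rfl : k = k) (α := ℝ) (t := 1) (e := 0), ← sum_gUp_mul_gLow g he hx k k]
    exact Finset.sum_congr rfl fun l _ => by rw [gLow_symm g e k l]
  simp [tr, h]

theorem tr_gLow_mul' (i : Fin n) (v : Fin n → ℝ) :
    tr g e x (fun k l => gLow g e k i x * v l) = v i := by
  rw [← tr_gLow_mul g he hx i v]
  exact tr_congr g e x fun k l => by rw [gLow_symm]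

theorem tr_mul_gLow (i : Fin n) (v : Fin n → ℝ) :
    tr g e x (fun k l => v k * gLow g e i l x) = v i := by
  rw [← tr_gLow_mul g he hx i v, tr_transpose]
  exact tr_congr g e x fun k l => by rw [mul_comm]

theorem pd_tr {φ : Fin n → Fin n → EuclideanSpace ℝ (Fin n) → ℝ}
    (hφ : ∀ k l, DifferentiableAt ℝ (φ k l) x) (m : Fin n) :
    pd m (fun y => tr g e y fun k l => φ k l y) x =
      tr g e x fun k l => (pd m (φ k l) x - ∑ r, christoffel g e r m k x * φ r l x -
        ∑ r, christoffel g e r m l x * φ k r x) :=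
  pd_trace g he hx hφ m

end Trace

theorem contDiffOn_tr (g : SmoothMetric n M)
    {e : OpenPartialHomeomorph M (EuclideanSpace ℝ (Fin n))}
    (he : e ∈ IsManifold.maximalAtlas (𝓡 n) ∞ M)
    {φ : Fin n → Fin n → EuclideanSpace ℝ (Fin n) → ℝ}
    (hφ : ∀ k l, ContDiffOn ℝ ∞ (φ k l) e.target) :
    ContDiffOn ℝ ∞ (fun y => tr g e y fun k l => φ k l y) e.target :=
  ContDiffOn.sum fun k _ => ContDiffOn.sum fun l _ => (contDiffOn_gUp g he k l).mul (hφ k l)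

/-! ### Covariant derivatives in low rank -/

section Nabla

variable (g : SmoothMetric n M) (e : OpenPartialHomeomorph M (EuclideanSpace ℝ (Fin n)))
  (x : EuclideanSpace ℝ (Fin n)) (m i j k l p : Fin n)

theorem nabla_rank_zero (T : Comp n 0) : nabla g e T ![m] x = pd m (T ![]) x := by
  have h := nabla_cons g e T m ![] x
  simpa using h

theorem nabla_rank_one (T : Comp n 1) : nabla g e T ![m, i] x =
    pd m (T ![i]) x - ∑ r, christoffel g e r m i x * T ![r] x := by
  have h := nabla_cons g e T m ![i] x
  have u0 : ∀ r, Function.update ![i] 0 r = ![r] := fun r => by ext a; fin_cases a; rfl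
  simp only [Fin.sum_univ_one, u0] at h
  exact h

theorem nabla_rank_two (T : Comp n 2) : nabla g e T ![m, i, j] x =
    pd m (T ![i, j]) x - ∑ r, christoffel g e r m i x * T ![r, j] x -
      ∑ r, christoffel g e r m j x * T ![i, r] x := by
  have h := nabla_cons g e T m ![i, j] x
  have u0 : ∀ r, Function.update ![i, j] 0 r = ![r, j] := fun r => by ext a; fin_cases a <;> rfl
  have u1 : ∀ r, Function.update ![i, j] 1 r = ![i, r] := fun r => by ext a; fin_cases a <;> rfl
  simp only [Fin.sum_univ_two, u0, u1, ← sub_sub] at h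
  exact h

theorem nabla_rank_three (T : Comp n 3) : nabla g e T ![m, i, j, k] x =
    pd m (T ![i, j, k]) x - ∑ r, christoffel g e r m i x * T ![r, j, k] x -
      ∑ r, christoffel g e r m j x * T ![i, r, k] x -
      ∑ r, christoffel g e r m k x * T ![i, j, r] x := by
  have h := nabla_cons g e T m ![i, j, k] x
  have u0 : ∀ r, Function.update ![i, j, k] 0 r = ![r, j, k] := fun r => by
    ext a; fin_cases a <;> rfl
  have u1 : ∀ r, Function.update ![i, j, k] 1 r = ![i, r, k] := fun r => by
    ext a; fin_cases a <;> rfl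
  have u2 : ∀ r, Function.update ![i, j, k] 2 r = ![i, j, r] := fun r => by
    ext a; fin_cases a <;> rfl
  simp only [Fin.sum_univ_three, u0, u1, u2, ← sub_sub] at h
  exact h

theorem nabla_rank_four (T : Comp n 4) : nabla g e T ![m, i, j, k, l] x =
    pd m (T ![i, j, k, l]) x - ∑ r, christoffel g e r m i x * T ![r, j, k, l] x -
      ∑ r, christoffel g e r m j x * T ![i, r, k, l] x -
      ∑ r, christoffel g e r m k x * T ![i, j, r, l] x -
      ∑ r, christoffel g e r m l x * T ![i, j, k, r] x := by
  have h := nabla_cons g e T m ![i, j, k, l] x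
  have u0 : ∀ r, Function.update ![i, j, k, l] 0 r = ![r, j, k, l] := fun r => by
    ext a; fin_cases a <;> rfl
  have u1 : ∀ r, Function.update ![i, j, k, l] 1 r = ![i, r, k, l] := fun r => by
    ext a; fin_cases a <;> rfl
  have u2 : ∀ r, Function.update ![i, j, k, l] 2 r = ![i, j, r, l] := fun r => by
    ext a; fin_cases a <;> rfl
  have u3 : ∀ r, Function.update ![i, j, k, l] 3 r = ![i, j, k, r] := fun r => by
    ext a; fin_cases a <;> rfl
  simp only [Fin.sum_univ_four, u0, u1, u2, u3, ← sub_sub] at h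
  exact h

/-- Rank five is the highest needed: it occurs when `∇W` is differentiated once more in the Bach
tensor. -/
theorem nabla_rank_five (T : Comp n 5) : nabla g e T ![m, i, j, k, l, p] x =
    pd m (T ![i, j, k, l, p]) x - ∑ r, christoffel g e r m i x * T ![r, j, k, l, p] x -
      ∑ r, christoffel g e r m j x * T ![i, r, k, l, p] x -
      ∑ r, christoffel g e r m k x * T ![i, j, r, l, p] x -
      ∑ r, christoffel g e r m l x * T ![i, j, k, r, p] x -
      ∑ r, christoffel g e r m p x * T ![i, j, k, l, r] x := by
  have h := nabla_cons g e T m ![i, j, k, l, p] x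
  have u0 : ∀ r, Function.update ![i, j, k, l, p] 0 r = ![r, j, k, l, p] := fun r => by
    ext a; fin_cases a <;> rfl
  have u1 : ∀ r, Function.update ![i, j, k, l, p] 1 r = ![i, r, k, l, p] := fun r => by
    ext a; fin_cases a <;> rfl
  have u2 : ∀ r, Function.update ![i, j, k, l, p] 2 r = ![i, j, r, l, p] := fun r => by
    ext a; fin_cases a <;> rfl
  have u3 : ∀ r, Function.update ![i, j, k, l, p] 3 r = ![i, j, k, r, p] := fun r => by
    ext a; fin_cases a <;> rfl
  have u4 : ∀ r, Function.update ![i, j, k, l, p] 4 r = ![i, j, k, l, r] := fun r => by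
    ext a; fin_cases a <;> rfl
  simp only [Fin.sum_univ_five, u0, u1, u2, u3, u4, ← sub_sub] at h
  exact h

end Nabla

/-! ### Rules for the covariant derivative -/

/-- The Kulkarni-Nomizu product of the metric with a tensor of rank `2`. -/
def kulkarni (g : SmoothMetric n M)
    (e : OpenPartialHomeomorph M (EuclideanSpace ℝ (Fin n))) (T : Comp n 2) : Comp n 4 := fun I x =>
  gLow g e (I 0) (I 2) x * T ![I 1, I 3] x - gLow g e (I 0) (I 3) x * T ![I 1, I 2] x -
    gLow g e (I 1) (I 2) x * T ![I 0, I 3] x + gLow g e (I 1) (I 3) x * T ![I 0, I 2] x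

section Rules

variable (g : SmoothMetric n M) {e : OpenPartialHomeomorph M (EuclideanSpace ℝ (Fin n))}
  {x : EuclideanSpace ℝ (Fin n)} (hx : x ∈ e.target) {r : ℕ}

include hx

/-- The chart target is open, so a tensor identity valid throughout it may be differentiated. Every
use of "differentiate this identity" below rests on this. -/
theorem nabla_congr {T S : Comp n r} (h : ∀ I, ∀ y ∈ e.target, T I y = S I y)
    (I : Fin (r + 1) → Fin n) : nabla g e T I x = nabla g e S I x := by
  simp only [nabla, pd_congr e.open_target hx (h _), h _ x hx]

theorem nabla_sub {T S : Comp n r} (hT : ∀ I, ContDiffOn ℝ ∞ (T I) e.target)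
    (hS : ∀ I, ContDiffOn ℝ ∞ (S I) e.target) (I : Fin (r + 1) → Fin n) :
    nabla g e (fun J y => T J y - S J y) I x = nabla g e T I x - nabla g e S I x := by
  simp only [nabla, pd_sub _ ((hT _).diffAt e.open_target hx) ((hS _).diffAt e.open_target hx),
    mul_sub, Finset.sum_sub_distrib]
  ring

theorem nabla_mul {φ : EuclideanSpace ℝ (Fin n) → ℝ} {T : Comp n r}
    (hφ : ContDiffOn ℝ ∞ φ e.target)
    (hT : ∀ I, ContDiffOn ℝ ∞ (T I) e.target) (I : Fin (r + 1) → Fin n) :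
    nabla g e (fun J y => φ y * T J y) I x =
      pd (I 0) φ x * T (Fin.tail I) x + φ x * nabla g e T I x := by
  simp only [nabla, pd_mul _ (hφ.diffAt e.open_target hx) ((hT _).diffAt e.open_target hx),
    mul_sub, Finset.mul_sum, mul_left_comm (φ x)]
  ring

theorem nabla_const_mul (c : ℝ) {T : Comp n r} (hT : ∀ I, ContDiffOn ℝ ∞ (T I) e.target)
    (I : Fin (r + 1) → Fin n) :
    nabla g e (fun J y => c * T J y) I x = c * nabla g e T I x := by
  rw [nabla_mul g hx contDiffOn_const hT, pd_const]
  ring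

variable (he : e ∈ IsManifold.maximalAtlas (𝓡 n) ∞ M)
include he

theorem nabla_gLow (I : Fin 3 → Fin n) :
    nabla g e (fun J => gLow g e (J 0) (J 1)) I x = 0 := by
  have hI : I = ![I 0, I 1, I 2] := by ext a; fin_cases a <;> rfl
  rw [hI, nabla_rank_two]
  simp only [Matrix.cons_val_zero, Matrix.cons_val_one]
  rw [pd_gLow g he hx]
  ring

theorem nabla_mul_gLow {φ : EuclideanSpace ℝ (Fin n) → ℝ} (hφ : ContDiffOn ℝ ∞ φ e.target)
    (m i j : Fin n) : nabla g e (fun J y => φ y * gLow g e (J 0) (J 1) y) ![m, i, j] x =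
      pd m φ x * gLow g e i j x := by
  rw [nabla_mul g hx hφ (T := fun J => gLow g e (J 0) (J 1)) fun I => contDiffOn_gLow g he _ _,
    nabla_gLow g hx he]
  simp [Fin.tail]

theorem nabla_tr_rank_two {T : Comp n 2} (hT : ∀ I, ContDiffOn ℝ ∞ (T I) e.target) (m : Fin n) :
    pd m (fun y => tr g e y fun i j => T ![i, j] y) x =
      tr g e x fun i j => nabla g e T ![m, i, j] x := by
  rw [pd_tr g he hx fun i j => (hT _).diffAt e.open_target hx]
  simp only [nabla_rank_two]

/-- By `pd_tr` the contracted slots acquire their Christoffel corrections; those of the free slots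
are already present. The variants that follow differ in which slots are contracted. -/
theorem nabla_tr_rank_four {T : Comp n 4} (hT : ∀ I, ContDiffOn ℝ ∞ (T I) e.target)
    (m j l : Fin n) :
    nabla g e (fun J y => tr g e y fun i k => T ![i, J 0, k, J 1] y) ![m, j, l] x =
      tr g e x fun i k => nabla g e T ![m, i, j, k, l] x := by
  rw [nabla_rank_two]
  simp only [Matrix.cons_val_zero, Matrix.cons_val_one]
  rw [pd_tr g he hx fun i j => (hT _).diffAt e.open_target hx]
  simp only [nabla_rank_four, sum_mul_tr, ← tr_sub]
  exact tr_congr g e x fun i k => by ring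

theorem nabla_tr_rank_four' {T : Comp n 4} (hT : ∀ I, ContDiffOn ℝ ∞ (T I) e.target)
    (m j l : Fin n) :
    nabla g e (fun J y => tr g e y fun i k => T ![k, i, J 0, J 1] y) ![m, j, l] x =
      tr g e x fun i k => nabla g e T ![m, k, i, j, l] x := by
  rw [nabla_rank_two]
  simp only [Matrix.cons_val_zero, Matrix.cons_val_one]
  rw [pd_tr g he hx fun i j => (hT _).diffAt e.open_target hx]
  simp only [nabla_rank_four, sum_mul_tr, ← tr_sub]
  exact tr_congr g e x fun i k => by ring

theorem nabla_tr_rank_five {T : Comp n 5} (hT : ∀ I, ContDiffOn ℝ ∞ (T I) e.target)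
    (m i j k : Fin n) :
    nabla g e (fun J y => tr g e y fun l b => T ![b, J 0, J 1, J 2, l] y) ![m, i, j, k] x =
      tr g e x fun l b => nabla g e T ![m, b, i, j, k, l] x := by
  rw [nabla_rank_three]
  simp only [Matrix.cons_val_zero, Matrix.cons_val_one, Matrix.cons_val]
  rw [pd_tr g he hx fun i j => (hT _).diffAt e.open_target hx]
  simp only [nabla_rank_five, sum_mul_tr, ← tr_sub]
  exact tr_congr g e x fun i k => by ring

/-- Leibniz rule for a contracted product. It is applied to `Ric(∇f)`, and the rank four analogue to
`Rm(∇f)`. -/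
theorem nabla_tr_two_one {T : Comp n 2} (hT : ∀ I, ContDiffOn ℝ ∞ (T I) e.target)
    {S : Comp n 1} (hS : ∀ I, ContDiffOn ℝ ∞ (S I) e.target) (m i : Fin n) :
    nabla g e (fun (J : Fin 1 → Fin n) y => tr g e y fun p q => T ![J 0, p] y * S ![q] y)
      ![m, i] x =
      tr g e x fun p q => nabla g e T ![m, i, p] x * S ![q] x +
        T ![i, p] x * nabla g e S ![m, q] x := by
  have hTx : ∀ I, DifferentiableAt ℝ (T I) x := fun I => (hT I).diffAt e.open_target hx
  have hSx : ∀ I, DifferentiableAt ℝ (S I) x := fun I => (hS I).diffAt e.open_target hx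
  rw [nabla_rank_one]
  simp only [Matrix.cons_val_zero]
  rw [pd_tr g he hx fun p q => (hTx ![i, p]).fun_mul (hSx ![q])]
  simp only [nabla_rank_two, nabla_rank_one, sum_mul_tr, ← tr_sub, pd_mul _ (hTx _) (hSx _)]
  refine tr_congr g e x fun p q => ?_
  simp only [sub_mul, mul_sub, Finset.sum_mul, Finset.mul_sum, mul_assoc,
    mul_left_comm (T ![i, p] x)]
  ring

theorem nabla_tr_four_one {T : Comp n 4} (hT : ∀ I, ContDiffOn ℝ ∞ (T I) e.target)
    {S : Comp n 1} (hS : ∀ I, ContDiffOn ℝ ∞ (S I) e.target) (m i j k : Fin n) :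
    nabla g e (fun (J : Fin 3 → Fin n) y => tr g e y fun p q => T ![J 0, J 1, J 2, p] y * S ![q] y)
      ![m, i, j, k] x =
      tr g e x fun p q => nabla g e T ![m, i, j, k, p] x * S ![q] x +
        T ![i, j, k, p] x * nabla g e S ![m, q] x := by
  have hTx : ∀ I, DifferentiableAt ℝ (T I) x := fun I => (hT I).diffAt e.open_target hx
  have hSx : ∀ I, DifferentiableAt ℝ (S I) x := fun I => (hS I).diffAt e.open_target hx
  rw [nabla_rank_three]
  simp only [Matrix.cons_val_zero, Matrix.cons_val_one, Matrix.cons_val]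
  rw [pd_tr g he hx fun p q => (hTx ![i, j, k, p]).fun_mul (hSx ![q])]
  simp only [nabla_rank_four, nabla_rank_one, sum_mul_tr, ← tr_sub, pd_mul _ (hTx _) (hSx _)]
  refine tr_congr g e x fun p q => ?_
  simp only [sub_mul, mul_sub, Finset.sum_mul, Finset.mul_sum, mul_assoc,
    mul_left_comm (T ![i, j, k, p] x)]
  ring

/-- Since the metric is parallel, only the second factor is differentiated. -/
theorem nabla_kulkarni {T : Comp n 2} (hT : ∀ I, ContDiffOn ℝ ∞ (T I) e.target)
    (m i j k l : Fin n) :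
    nabla g e (kulkarni g e T) ![m, i, j, k, l] x =
      gLow g e i k x * nabla g e T ![m, j, l] x - gLow g e i l x * nabla g e T ![m, j, k] x -
        gLow g e j k x * nabla g e T ![m, i, l] x + gLow g e j l x * nabla g e T ![m, i, k] x := by
  have hTx : ∀ I, DifferentiableAt ℝ (T I) x := fun I => (hT I).diffAt e.open_target hx
  have hL : ∀ a b, DifferentiableAt ℝ (gLow g e a b) x := fun a b =>
    (contDiffOn_gLow g he a b).diffAt e.open_target hx
  have hp : ∀ a b c d, DifferentiableAt ℝ (fun y => gLow g e a b y * T ![c, d] y) x :=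
    fun a b c d => (hL a b).fun_mul (hTx _)
  have h : pd m (kulkarni g e T ![i, j, k, l]) x =
      (pd m (gLow g e i k) x * T ![j, l] x + gLow g e i k x * pd m (T ![j, l]) x) -
      (pd m (gLow g e i l) x * T ![j, k] x + gLow g e i l x * pd m (T ![j, k]) x) -
      (pd m (gLow g e j k) x * T ![i, l] x + gLow g e j k x * pd m (T ![i, l]) x) +
      (pd m (gLow g e j l) x * T ![i, k] x + gLow g e j l x * pd m (T ![i, k]) x) := by
    simp only [← pd_mul m (hL _ _) (hTx _)]
    rw [← pd_sub m (hp _ _ _ _) (hp _ _ _ _), ← pd_sub m ((hp _ _ _ _).fun_sub (hp _ _ _ _))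
      (hp _ _ _ _), ← pd_add m (((hp _ _ _ _).fun_sub (hp _ _ _ _)).fun_sub (hp _ _ _ _))
      (hp _ _ _ _)]
    rfl
  rw [nabla_rank_four, h]
  simp only [pd_gLow g he hx, nabla_rank_two, kulkarni, Matrix.cons_val_zero, Matrix.cons_val_one,
    Matrix.cons_val, mul_sub, mul_add, add_mul, Finset.sum_sub_distrib, Finset.sum_add_distrib,
    Finset.sum_mul, Finset.mul_sum, mul_left_comm (christoffel _ _ _ _ _ _), ← mul_assoc]
  simp only [mul_assoc, mul_left_comm (christoffel _ _ _ _ _ _)]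
  ring

end Rules

/-! ### Curvature identities -/

section Curvature

/-- The covariant derivative of the curvature as an endomorphism-valued form, without the
Christoffel terms of the form indices. -/
def curvDeriv (g : SmoothMetric n M) (e : OpenPartialHomeomorph M (EuclideanSpace ℝ (Fin n)))
    (c a b m l : Fin n) (x : EuclideanSpace ℝ (Fin n)) : ℝ :=
  pd c (curv g e m a b l) x + ∑ p, christoffel g e m c p x * curv g e p a b l x -
    ∑ p, curv g e m a b p x * christoffel g e p c l x

variable (g : SmoothMetric n M) {e : OpenPartialHomeomorph M (EuclideanSpace ℝ (Fin n))}

theorem riemann_eq_sum_curv (e : OpenPartialHomeomorph M (EuclideanSpace ℝ (Fin n)))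
    (i j k l : Fin n) (x : EuclideanSpace ℝ (Fin n)) :
    riemann g e ![i, j, k, l] x = ∑ m, gLow g e k m x * curv g e m i j l x := rfl

theorem ricci_eq_tr (e : OpenPartialHomeomorph M (EuclideanSpace ℝ (Fin n)))
    (i j : Fin n) (x : EuclideanSpace ℝ (Fin n)) :
    ricci g e ![i, j] x = tr g e x fun p q => riemann g e ![p, i, q, j] x := rfl

theorem scal_eq_tr (e : OpenPartialHomeomorph M (EuclideanSpace ℝ (Fin n)))
    (x : EuclideanSpace ℝ (Fin n)) :
    scal g e x = tr g e x fun i j => ricci g e ![i, j] x := rfl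

theorem curv_antisymm (e : OpenPartialHomeomorph M (EuclideanSpace ℝ (Fin n)))
    (m a b l : Fin n) (x : EuclideanSpace ℝ (Fin n)) :
    curv g e m a b l x = -curv g e m b a l x := by
  simp only [curv, Finset.sum_sub_distrib]
  ring

/-- The first Bianchi identity: once the lower indices of the Christoffel symbols are exchanged
freely, the terms cancel in pairs. -/
theorem curv_cyclic (e : OpenPartialHomeomorph M (EuclideanSpace ℝ (Fin n)))
    (m a b l : Fin n) (x : EuclideanSpace ℝ (Fin n)) :
    curv g e m a b l x + curv g e m b l a x + curv g e m l a b x = 0 := by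
  have h : ∀ i j, christoffel g e m i j = christoffel g e m j i := fun i j =>
    funext fun y => christoffel_symm g e m i j y
  simp only [curv, Finset.sum_sub_distrib]
  rw [h l a, h a b, h b l]
  simp only [christoffel_symm g e _ a l, christoffel_symm g e _ b a, christoffel_symm g e _ l b]
  ring

theorem riemann_antisymm (e : OpenPartialHomeomorph M (EuclideanSpace ℝ (Fin n)))
    (i j k l : Fin n) (x : EuclideanSpace ℝ (Fin n)) :
    riemann g e ![i, j, k, l] x = -riemann g e ![j, i, k, l] x := by
  simp only [riemann_eq_sum_curv, curv_antisymm g e _ i j, mul_neg, Finset.sum_neg_distrib]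

theorem riemann_cyclic (e : OpenPartialHomeomorph M (EuclideanSpace ℝ (Fin n)))
    (i j k l : Fin n) (x : EuclideanSpace ℝ (Fin n)) :
    riemann g e ![i, j, k, l] x + riemann g e ![j, l, k, i] x + riemann g e ![l, i, k, j] x = 0 := by
  simp only [riemann_eq_sum_curv, ← Finset.sum_add_distrib, ← mul_add, curv_cyclic]
  simp

section Smoothness

variable (he : e ∈ IsManifold.maximalAtlas (𝓡 n) ∞ M)
include he

theorem contDiffOn_curv (m a b l : Fin n) : ContDiffOn ℝ ∞ (curv g e m a b l) e.target :=
  ((contDiffOn_pd e.open_target (contDiffOn_christoffel g he _ _ _) _).sub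
    (contDiffOn_pd e.open_target (contDiffOn_christoffel g he _ _ _) _)).add
    (ContDiffOn.sum fun _ _ =>
      ((contDiffOn_christoffel g he _ _ _).mul (contDiffOn_christoffel g he _ _ _)).sub
        ((contDiffOn_christoffel g he _ _ _).mul (contDiffOn_christoffel g he _ _ _)))

theorem contDiffOn_riemann (I : Fin 4 → Fin n) : ContDiffOn ℝ ∞ (riemann g e I) e.target :=
  ContDiffOn.sum fun _ _ => (contDiffOn_gLow g he _ _).mul (contDiffOn_curv g he _ _ _ _)

theorem contDiffOn_ricci (I : Fin 2 → Fin n) : ContDiffOn ℝ ∞ (ricci g e I) e.target :=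
  contDiffOn_tr g he fun _ _ => contDiffOn_riemann g he _

theorem contDiffOn_scal : ContDiffOn ℝ ∞ (scal g e) e.target :=
  contDiffOn_tr g he fun _ _ => contDiffOn_ricci g he _

end Smoothness

variable (he : e ∈ IsManifold.maximalAtlas (𝓡 n) ∞ M) {x : EuclideanSpace ℝ (Fin n)}
  (hx : x ∈ e.target)
include he hx

/-- The Ricci identity applied to the parallel tensor `g`: its second covariant derivatives vanish,
and the curvature terms of the two slots must cancel. -/
theorem riemann_antisymm_right (i j k l : Fin n) :
    riemann g e ![i, j, k, l] x = -riemann g e ![i, j, l, k] x := by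
  have h := ricci_identity g he hx (T := fun J => gLow g e (J 0) (J 1))
    (fun I => contDiffOn_gLow g he _ _) i j ![k, l]
  have hz : ∀ I, nabla g e (nabla g e fun J : Fin 2 → Fin n => gLow g e (J 0) (J 1)) I x = 0 := by
    intro I
    rw [nabla_congr g hx (S := fun _ _ => 0) fun J y hy => nabla_gLow g hy he J]
    simp [nabla, pd_const]
  rw [hz, hz] at h
  have u0 : ∀ r, Function.update ![k, l] 0 r = ![r, l] := fun r => by ext a; fin_cases a <;> rfl
  have u1 : ∀ r, Function.update ![k, l] 1 r = ![k, r] := fun r => by ext a; fin_cases a <;> rfl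
  simp only [Fin.sum_univ_two, u0, u1, Matrix.cons_val_zero, Matrix.cons_val_one] at h
  have h1 : ∑ r, curv g e r i j k x * gLow g e r l x = riemann g e ![i, j, l, k] x :=
    Finset.sum_congr rfl fun r _ => by rw [gLow_symm g e r l, mul_comm]; rfl
  have h2 : ∑ r, curv g e r i j l x * gLow g e k r x = riemann g e ![i, j, k, l] x :=
    Finset.sum_congr rfl fun r _ => by rw [mul_comm]; rfl
  rw [h1, h2] at h
  linarith

theorem riemann_pair_symm (i j k l : Fin n) :
    riemann g e ![i, j, k, l] x = riemann g e ![k, l, i, j] x := by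
  have c := fun i j k l => riemann_cyclic g e i j k l x
  have a := fun i j k l => riemann_antisymm g e i j k l x
  have b := riemann_antisymm_right g he hx
  -- The usual octahedron argument: four cyclic identities are combined, and the two antisymmetries
  -- identify the terms.
  linarith [c i j k l, c j k l i, c k l i j, c l i j k, a i j k l, b i j k l, a j l k i, b j l k i,
    a l i k j, b l i k j, a j k l i, a k i l j, b j k l i, b k i l j, a i j l k, a k l i j,
    b k l i j, a l j i k, b l j i k, a j k i l, b j k i l, a l i j k, b l i j k, a i k j l,
    b i k j l, a k l j i, b k l j i]

theorem ricci_symm (i j : Fin n) : ricci g e ![i, j] x = ricci g e ![j, i] x := by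
  rw [ricci_eq_tr, ricci_eq_tr, tr_transpose]
  exact tr_congr g e x fun p q => riemann_pair_symm g he hx _ _ _ _

omit he in
-- The Christoffel corrections run over all slots, so permuting slots only reindexes their sum;
-- hence `∇T` inherits the slot symmetries of `T`. It is used with `c = 1` and `c = -1`.
theorem nabla_of_perm {r : ℕ} {T : Comp n r} (hT : ∀ I, ContDiffOn ℝ ∞ (T I) e.target)
    (σ : Equiv.Perm (Fin r)) (c : ℝ) (h : ∀ J, ∀ y ∈ e.target, T J y = c * T (J ∘ σ) y)
    (m : Fin n) (J : Fin r → Fin n) :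
    nabla g e T (Fin.cons m J) x = c * nabla g e T (Fin.cons m (J ∘ σ)) x := by
  have hsum : (∑ s, ∑ q, christoffel g e q m (J s) x * T (Function.update J s q ∘ σ) x) =
      ∑ s, ∑ q, christoffel g e q m ((J ∘ σ) s) x * T (Function.update (J ∘ σ) s q) x := by
    rw [← Equiv.sum_comp σ]
    refine Finset.sum_congr rfl fun s _ => Finset.sum_congr rfl fun q _ => ?_
    rw [Function.update_comp_equiv, Equiv.symm_apply_apply, Function.comp_apply]
  rw [nabla_congr g hx h, nabla_const_mul g hx c (T := fun J => T (J ∘ σ)) fun I => hT _,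
    nabla_cons, nabla_cons, hsum]

theorem nabla_ricci_symm (m i j : Fin n) :
    nabla g e (ricci g e) ![m, i, j] x = nabla g e (ricci g e) ![m, j, i] x := by
  have hσ : ∀ J : Fin 2 → Fin n, J ∘ Equiv.swap 0 1 = ![J 1, J 0] := fun J => by
    ext a; fin_cases a <;> rfl
  have h := nabla_of_perm g hx (contDiffOn_ricci g he) (Equiv.swap 0 1) 1
    (fun J y hy => by
      rw [hσ, one_mul, ← ricci_symm g he hy]
      congr 1; ext a; fin_cases a <;> rfl) m ![i, j]
  rw [hσ, one_mul] at h
  exact h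

theorem nabla_riemann_antisymm (m i j k l : Fin n) :
    nabla g e (riemann g e) ![m, i, j, k, l] x = -nabla g e (riemann g e) ![m, j, i, k, l] x := by
  have hσ : ∀ J : Fin 4 → Fin n, J ∘ Equiv.swap 0 1 = ![J 1, J 0, J 2, J 3] := fun J => by
    ext a; fin_cases a <;> rfl
  have h := nabla_of_perm g hx (contDiffOn_riemann g he) (Equiv.swap 0 1) (-1)
    (fun J y hy => by
      rw [hσ, neg_one_mul, ← riemann_antisymm g e]
      congr 1; ext a; fin_cases a <;> rfl) m ![i, j, k, l]
  rw [hσ, neg_one_mul] at h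
  exact h

theorem nabla_riemann_antisymm_right (m i j k l : Fin n) :
    nabla g e (riemann g e) ![m, i, j, k, l] x = -nabla g e (riemann g e) ![m, i, j, l, k] x := by
  have hσ : ∀ J : Fin 4 → Fin n, J ∘ Equiv.swap 2 3 = ![J 0, J 1, J 3, J 2] := fun J => by
    ext a; fin_cases a <;> rfl
  have h := nabla_of_perm g hx (contDiffOn_riemann g he) (Equiv.swap 2 3) (-1)
    (fun J y hy => by
      rw [hσ, neg_one_mul, ← riemann_antisymm_right g he hy]
      congr 1; ext a; fin_cases a <;> rfl) m ![i, j, k, l]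
  rw [hσ, neg_one_mul] at h
  exact h

theorem nabla_riemann_pair_symm (m i j k l : Fin n) :
    nabla g e (riemann g e) ![m, i, j, k, l] x = nabla g e (riemann g e) ![m, k, l, i, j] x := by
  have hσ : ∀ J : Fin 4 → Fin n, J ∘ (Equiv.swap 0 2 * Equiv.swap 1 3 : Equiv.Perm (Fin 4)) =
      ![J 2, J 3, J 0, J 1] := fun J => by
    ext a; fin_cases a <;> rfl
  have h := nabla_of_perm g hx (contDiffOn_riemann g he) (Equiv.swap 0 2 * Equiv.swap 1 3) 1
    (fun J y hy => by
      rw [hσ, one_mul, ← riemann_pair_symm g he hy]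
      congr 1; ext a; fin_cases a <;> rfl) m ![i, j, k, l]
  rw [hσ, one_mul] at h
  exact h

theorem pd_curv (c m a b l : Fin n) : pd c (curv g e m a b l) x =
    pd c (pd a (christoffel g e m b l)) x - pd c (pd b (christoffel g e m a l)) x +
      ∑ p, ((pd c (christoffel g e m a p) x * christoffel g e p b l x +
          christoffel g e m a p x * pd c (christoffel g e p b l) x) -
        (pd c (christoffel g e m b p) x * christoffel g e p a l x +
          christoffel g e m b p x * pd c (christoffel g e p a l) x)) := by
  have hΓ : ∀ p q r, DifferentiableAt ℝ (christoffel g e p q r) x := fun p q r =>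
    (contDiffOn_christoffel g he p q r).diffAt e.open_target hx
  have hdΓ : ∀ s p q r, DifferentiableAt ℝ (pd s (christoffel g e p q r)) x := fun s p q r =>
    (contDiffOn_pd e.open_target (contDiffOn_christoffel g he p q r) s).diffAt e.open_target hx
  have hq : ∀ p, DifferentiableAt ℝ (fun y => christoffel g e m a p y * christoffel g e p b l y -
      christoffel g e m b p y * christoffel g e p a l y) x := fun p =>
    ((hΓ _ _ _).fun_mul (hΓ _ _ _)).fun_sub ((hΓ _ _ _).fun_mul (hΓ _ _ _))
  unfold curv
  rw [pd_add _ ((hdΓ _ _ _ _).fun_sub (hdΓ _ _ _ _)) (DifferentiableAt.fun_sum fun p _ => hq p),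
    pd_sub _ (hdΓ _ _ _ _) (hdΓ _ _ _ _), pd_sum _ _ fun p _ => hq p]
  congr 1
  refine Finset.sum_congr rfl fun p _ => ?_
  rw [pd_sub _ ((hΓ _ _ _).fun_mul (hΓ _ _ _)) ((hΓ _ _ _).fun_mul (hΓ _ _ _)),
    pd_mul _ (hΓ _ _ _) (hΓ _ _ _), pd_mul _ (hΓ _ _ _) (hΓ _ _ _)]

/-- The second Bianchi identity for the curvature of the connection matrices `Γ_a`. -/
theorem curv_bianchi (c a b m l : Fin n) :
    curvDeriv g e c a b m l x + curvDeriv g e a b c m l x + curvDeriv g e b c a m l x = 0 := by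
  let Γ : Fin n → Matrix (Fin n) (Fin n) ℝ := fun a => Matrix.of fun m l => christoffel g e m a l x
  let dΓ : Fin n → Fin n → Matrix (Fin n) (Fin n) ℝ := fun a b =>
    Matrix.of fun m l => pd a (christoffel g e m b l) x
  let ddΓ : Fin n → Fin n → Fin n → Matrix (Fin n) (Fin n) ℝ := fun c a b =>
    Matrix.of fun m l => pd c (pd a (christoffel g e m b l)) x
  let F : Fin n → Fin n → Matrix (Fin n) (Fin n) ℝ := fun a b =>
    Matrix.of fun m l => curv g e m a b l x
  let dF : Fin n → Fin n → Fin n → Matrix (Fin n) (Fin n) ℝ := fun c a b =>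
    Matrix.of fun m l => pd c (curv g e m a b l) x
  have hF : ∀ a b, F a b = dΓ a b - dΓ b a + (Γ a * Γ b - Γ b * Γ a) := by
    intro a b
    ext m l
    simp [F, dΓ, Γ, curv, Matrix.mul_apply, Finset.sum_sub_distrib]
  have hdF : ∀ c a b, dF c a b = ddΓ c a b - ddΓ c b a +
      ((dΓ c a * Γ b + Γ a * dΓ c b) - (dΓ c b * Γ a + Γ b * dΓ c a)) := by
    intro c a b
    ext m l
    simp [dF, ddΓ, dΓ, Γ, pd_curv g he hx, Matrix.mul_apply, Finset.sum_sub_distrib,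
      Finset.sum_add_distrib]
  have hdd : ∀ c a b, ddΓ c a b = ddΓ a c b := by
    intro c a b
    ext m l
    exact pd_comm e.open_target (contDiffOn_christoffel g he m b l) hx c a
  -- With `F = dΓ + Γ ∧ Γ` this is `d_Γ F = 0`. Once mixed partials are matched by `hdd`, the
  -- cancellation is formal in noncommuting matrices.
  have key : (dF c a b + Γ c * F a b - F a b * Γ c) + (dF a b c + Γ a * F b c - F b c * Γ a) +
      (dF b c a + Γ b * F c a - F c a * Γ b) = 0 := by
    simp only [hF, hdF]
    rw [hdd c a b, hdd c b a, hdd a b c]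
    noncomm_ring
  have := congrFun (congrFun key m) l
  simpa [curvDeriv, dF, F, Γ, Matrix.mul_apply] using this

/-- Metric compatibility absorbs the correction of the lowered third index, and the fourth index is
already accounted for in `curvDeriv`. Only the corrections of the two form indices remain. -/
theorem nabla_riemann_eq (c a b k l : Fin n) : nabla g e (riemann g e) ![c, a, b, k, l] x =
    ∑ m, gLow g e k m x * curvDeriv g e c a b m l x -
    ∑ r, christoffel g e r c a x * riemann g e ![r, b, k, l] x -
    ∑ r, christoffel g e r c b x * riemann g e ![a, r, k, l] x := by
  have hC : ∀ m a b l, DifferentiableAt ℝ (curv g e m a b l) x := fun m a b l =>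
    (contDiffOn_curv g he m a b l).diffAt e.open_target hx
  have hL : ∀ a b, DifferentiableAt ℝ (gLow g e a b) x := fun a b =>
    (contDiffOn_gLow g he a b).diffAt e.open_target hx
  have hpd : pd c (riemann g e ![a, b, k, l]) x = ∑ m, (pd c (gLow g e k m) x * curv g e m a b l x +
      gLow g e k m x * pd c (curv g e m a b l) x) := by
    rw [show riemann g e ![a, b, k, l] = fun y => ∑ m, gLow g e k m y * curv g e m a b l y from rfl,
      pd_sum _ _ fun m _ => (hL k m).fun_mul (hC _ _ _ _)]
    exact Finset.sum_congr rfl fun m _ => pd_mul c (hL k m) (hC _ _ _ _)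
  rw [nabla_rank_four, hpd]
  have e1 : ∑ r, christoffel g e r c k x * riemann g e ![a, b, r, l] x =
      ∑ m, (∑ r, christoffel g e r c k x * gLow g e r m x) * curv g e m a b l x := by
    simp only [riemann_eq_sum_curv, Finset.mul_sum, Finset.sum_mul]
    rw [Finset.sum_comm]
    simp only [mul_assoc]
  have e2 : ∑ r, christoffel g e r c l x * riemann g e ![a, b, k, r] x =
      ∑ m, gLow g e k m x * ∑ p, curv g e m a b p x * christoffel g e p c l x := by
    simp only [riemann_eq_sum_curv, Finset.mul_sum]
    rw [Finset.sum_comm]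
    exact Finset.sum_congr rfl fun _ _ => Finset.sum_congr rfl fun _ _ => by ring
  have e3 : ∑ m, (∑ r, christoffel g e r c m x * gLow g e k r x) * curv g e m a b l x =
      ∑ m, gLow g e k m x * ∑ p, christoffel g e m c p x * curv g e p a b l x := by
    simp only [Finset.mul_sum, Finset.sum_mul]
    rw [Finset.sum_comm]
    exact Finset.sum_congr rfl fun _ _ => Finset.sum_congr rfl fun _ _ => by ring
  rw [e1, e2]
  simp only [curvDeriv, pd_gLow g he hx, add_mul, mul_add, mul_sub, Finset.sum_add_distrib,
    Finset.sum_sub_distrib, e3]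
  ring

theorem riemann_bianchi (c a b k l : Fin n) :
    nabla g e (riemann g e) ![c, a, b, k, l] x + nabla g e (riemann g e) ![a, b, c, k, l] x +
      nabla g e (riemann g e) ![b, c, a, k, l] x = 0 := by
  have hs : ∀ A B C : Fin n → ℝ, (∀ m, A m + B m + C m = 0) → ∑ m, gLow g e k m x * A m +
      ∑ m, gLow g e k m x * B m + ∑ m, gLow g e k m x * C m = 0 := by
    intro A B C h
    simp only [← Finset.sum_add_distrib, ← mul_add, h, mul_zero, Finset.sum_const_zero]
  have h := hs _ _ _ fun m => curv_bianchi g he hx c a b m l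
  beta_reduce at h
  -- Vanishing torsion and antisymmetry in the form indices pair off the remaining corrections in
  -- the cyclic sum.
  have s : ∀ a b c : Fin n, ∑ r, christoffel g e r a b x * riemann g e ![r, c, k, l] x =
      -∑ r, christoffel g e r b a x * riemann g e ![c, r, k, l] x := by
    intro a b c
    rw [← Finset.sum_neg_distrib]
    exact Finset.sum_congr rfl fun r _ => by
      rw [christoffel_symm g e r a b, riemann_antisymm g e r c]; ring
  rw [nabla_riemann_eq g he hx, nabla_riemann_eq g he hx, nabla_riemann_eq g he hx]
  rw [s c a b, s a b c, s b c a]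
  linarith

theorem nabla_ricci_eq_tr (m j l : Fin n) : nabla g e (ricci g e) ![m, j, l] x =
    tr g e x fun i k => nabla g e (riemann g e) ![m, i, j, k, l] x :=
  nabla_tr_rank_four g hx he (contDiffOn_riemann g he) m j l

theorem dScal_eq_tr (m : Fin n) : dScal g e m x =
    tr g e x fun i j => nabla g e (ricci g e) ![m, i, j] x :=
  nabla_tr_rank_two g hx he (contDiffOn_ricci g he) m

/-- The contracted second Bianchi identity `∇^k R_{ijkl} = ∇_i R_{jl} - ∇_j R_{il}`. -/
theorem tr_nabla_riemann (i j l : Fin n) :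
    (tr g e x fun k b => nabla g e (riemann g e) ![b, i, j, k, l] x) =
      nabla g e (ricci g e) ![i, j, l] x - nabla g e (ricci g e) ![j, i, l] x := by
  have h : (tr g e x fun k b => nabla g e (riemann g e) ![b, i, j, k, l] x +
      nabla g e (riemann g e) ![i, j, b, k, l] x + nabla g e (riemann g e) ![j, b, i, k, l] x) = 0 := by
    simp only [riemann_bianchi g he hx, tr_zero]
  rw [tr_add, tr_add] at h
  have h1 : (tr g e x fun k b => nabla g e (riemann g e) ![i, j, b, k, l] x) =
      -nabla g e (ricci g e) ![i, j, l] x := by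
    rw [nabla_ricci_eq_tr g he hx, ← tr_neg, tr_transpose]
    exact tr_congr g e x fun k b => nabla_riemann_antisymm g he hx _ _ _ _ _
  have h2 : (tr g e x fun k b => nabla g e (riemann g e) ![j, b, i, k, l] x) =
      nabla g e (ricci g e) ![j, i, l] x := by
    rw [nabla_ricci_eq_tr g he hx, tr_transpose]
  linarith

/-- The twice contracted second Bianchi identity `∇^i R_{ij} = ∂_j R / 2`. -/
theorem tr_nabla_ricci (j : Fin n) :
    (tr g e x fun i k => nabla g e (ricci g e) ![k, i, j] x) = 1 / 2 * dScal g e j x := by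
  -- One double trace of `∇Rm` is evaluated in both orders: contracting the derivative index first
  -- gives `dR - div Ric`, contracting the other pair first gives `div Ric`.
  have h : (tr g e x fun i l => tr g e x fun k b => nabla g e (riemann g e) ![b, j, i, k, l] x) =
      dScal g e j x - tr g e x fun i k => nabla g e (ricci g e) ![k, i, j] x := by
    simp only [tr_nabla_riemann g he hx, tr_sub, dScal_eq_tr g he hx]
    rw [sub_right_inj, tr_transpose]
    exact tr_congr g e x fun k b => nabla_ricci_symm g he hx _ _ _
  have h2 : (tr g e x fun i l => tr g e x fun k b => nabla g e (riemann g e) ![b, j, i, k, l] x) =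
      tr g e x fun i k => nabla g e (ricci g e) ![k, i, j] x := by
    rw [tr_comm]
    refine tr_congr g e x fun k b => ?_
    rw [nabla_ricci_symm g he hx, nabla_ricci_eq_tr g he hx]
    refine tr_congr g e x fun i l => ?_
    rw [nabla_riemann_antisymm g he hx, nabla_riemann_antisymm_right g he hx, neg_neg]
  linarith

end Curvature

/-! ### The Schouten, Cotton and Weyl tensors -/

/-- An algebraic curvature tensor in dimension three with vanishing Ricci contraction is zero. -/
theorem curvatureTensor_eq_zero_of_dim_three {W : Fin 3 → Fin 3 → Fin 3 → Fin 3 → ℝ}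
    {H : Matrix (Fin 3) (Fin 3) ℝ} (hl : ∀ i j k l, W i j k l = -W j i k l)
    (hr : ∀ i j k l, W i j k l = -W i j l k) (hp : ∀ i j k l, W i j k l = W k l i j)
    (hH : ∀ i j, H i j = H j i) (hdet : H.det ≠ 0)
    (hS : ∀ j l, ∑ i, ∑ k, H i k * W i j k l = 0) (i j k l : Fin 3) : W i j k l = 0 := by
  have zl : ∀ i k l, W i i k l = 0 := fun i k l => by linarith [hl i i k l]
  have zr : ∀ i j k, W i j k k = 0 := fun i j k => by linarith [hr i j k k]
  have s : ∀ j l, _ := hS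
  rw [Matrix.det_fin_three] at hdet
  simp only [Fin.sum_univ_three, hH 1 0, hH 2 0, hH 2 1] at s hdet
  have s00 := s 0 0
  have s01 := s 0 1
  have s02 := s 0 2
  have s11 := s 1 1
  have s12 := s 1 2
  have s22 := s 2 2
  simp only [zl, zr, hl 1 0, hl 2 0, hl 2 1, hr _ _ 1 0, hr _ _ 2 0,
    hr _ _ 2 1, hp 0 2 0 1, hp 1 2 0 1, hp 1 2 0 2] at s00 s01 s02 s11 s12 s22
  have main : ∀ w : ℝ,
      (H 0 0 * H 1 1 * H 2 2 - H 0 0 * H 1 2 * H 1 2 - H 0 1 * H 0 1 * H 2 2 +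
        H 0 1 * H 1 2 * H 0 2 + H 0 2 * H 0 1 * H 1 2 - H 0 2 * H 1 1 * H 0 2) * w = 0 →
      w = 0 := fun w h => (mul_eq_zero.1 h).resolve_left hdet
  -- With indices raised by `H`, the coefficients spell out `½ (tr S) H^{ab} - S^{ab}`, where `S` is
  -- the Ricci contraction. In dimension three this raised Einstein tensor is, up to sign, `det H`
  -- times the component of `W` on the planes dual to `a` and `b`. The factor `-1` in `w01` and
  -- `w12` is the orientation sign of the plane `(0, 2)`.
  have w00 : W 1 2 1 2 = 0 := main _ (by
    linear_combination (1 / 2 * H 0 0 * H 0 0 - H 0 0 * H 0 0) * s00 +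
      (H 0 1 * H 0 0 - H 0 0 * H 0 1 - H 0 1 * H 0 0) * s01 +
      (H 0 2 * H 0 0 - H 0 0 * H 0 2 - H 0 2 * H 0 0) * s02 +
      (1 / 2 * H 1 1 * H 0 0 - H 0 1 * H 0 1) * s11 +
      (H 1 2 * H 0 0 - H 0 1 * H 0 2 - H 0 2 * H 0 1) * s12 +
      (1 / 2 * H 2 2 * H 0 0 - H 0 2 * H 0 2) * s22)
  have w11 : W 0 2 0 2 = 0 := main _ (by
    linear_combination (1 / 2 * H 0 0 * H 1 1 - H 0 1 * H 0 1) * s00 +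
      (H 0 1 * H 1 1 - H 0 1 * H 1 1 - H 1 1 * H 0 1) * s01 +
      (H 0 2 * H 1 1 - H 0 1 * H 1 2 - H 1 2 * H 0 1) * s02 +
      (1 / 2 * H 1 1 * H 1 1 - H 1 1 * H 1 1) * s11 +
      (H 1 2 * H 1 1 - H 1 1 * H 1 2 - H 1 2 * H 1 1) * s12 +
      (1 / 2 * H 2 2 * H 1 1 - H 1 2 * H 1 2) * s22)
  have w22 : W 0 1 0 1 = 0 := main _ (by
    linear_combination (1 / 2 * H 0 0 * H 2 2 - H 0 2 * H 0 2) * s00 +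
      (H 0 1 * H 2 2 - H 0 2 * H 1 2 - H 1 2 * H 0 2) * s01 +
      (H 0 2 * H 2 2 - H 0 2 * H 2 2 - H 2 2 * H 0 2) * s02 +
      (1 / 2 * H 1 1 * H 2 2 - H 1 2 * H 1 2) * s11 +
      (H 1 2 * H 2 2 - H 1 2 * H 2 2 - H 2 2 * H 1 2) * s12 +
      (1 / 2 * H 2 2 * H 2 2 - H 2 2 * H 2 2) * s22)
  have w01 : W 0 2 1 2 = 0 := main _ (by
    linear_combination (-1) * ((1 / 2 * H 0 0 * H 0 1 - H 0 0 * H 0 1) * s00 +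
      (H 0 1 * H 0 1 - H 0 0 * H 1 1 - H 0 1 * H 0 1) * s01 +
      (H 0 2 * H 0 1 - H 0 0 * H 1 2 - H 0 2 * H 0 1) * s02 +
      (1 / 2 * H 1 1 * H 0 1 - H 0 1 * H 1 1) * s11 +
      (H 1 2 * H 0 1 - H 0 1 * H 1 2 - H 0 2 * H 1 1) * s12 +
      (1 / 2 * H 2 2 * H 0 1 - H 0 2 * H 1 2) * s22))
  have w02 : W 0 1 1 2 = 0 := main _ (by
    linear_combination (1 / 2 * H 0 0 * H 0 2 - H 0 0 * H 0 2) * s00 +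
      (H 0 1 * H 0 2 - H 0 0 * H 1 2 - H 0 1 * H 0 2) * s01 +
      (H 0 2 * H 0 2 - H 0 0 * H 2 2 - H 0 2 * H 0 2) * s02 +
      (1 / 2 * H 1 1 * H 0 2 - H 0 1 * H 1 2) * s11 +
      (H 1 2 * H 0 2 - H 0 1 * H 2 2 - H 0 2 * H 1 2) * s12 +
      (1 / 2 * H 2 2 * H 0 2 - H 0 2 * H 2 2) * s22)
  have w12 : W 0 1 0 2 = 0 := main _ (by
    linear_combination (-1) * ((1 / 2 * H 0 0 * H 1 2 - H 0 1 * H 0 2) * s00 +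
      (H 0 1 * H 1 2 - H 0 1 * H 1 2 - H 1 1 * H 0 2) * s01 +
      (H 0 2 * H 1 2 - H 0 1 * H 2 2 - H 1 2 * H 0 2) * s02 +
      (1 / 2 * H 1 1 * H 1 2 - H 1 1 * H 1 2) * s11 +
      (H 1 2 * H 1 2 - H 1 1 * H 2 2 - H 1 2 * H 1 2) * s12 +
      (1 / 2 * H 2 2 * H 1 2 - H 1 2 * H 2 2) * s22))
  have ext : ∀ F : Fin 3 → Fin 3 → ℝ, (∀ a b, F a b = -F b a) → F 0 1 = 0 → F 0 2 = 0 →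
      F 1 2 = 0 → ∀ a b, F a b = 0 := by
    intro F hF h01 h02 h12 a b
    have hd : ∀ a, F a a = 0 := fun a => by linarith [hF a a]
    fin_cases a <;> fin_cases b <;> first | exact hd _ | assumption | (rw [hF]; simpa)
  have right : ∀ i j, W i j 0 1 = 0 → W i j 0 2 = 0 → W i j 1 2 = 0 → ∀ k l, W i j k l = 0 :=
    fun i j => ext (W i j) (hr i j)
  refine ext (fun i j => W i j k l) (fun i j => hl i j k l) ?_ ?_ ?_ i j
  · exact right 0 1 w22 w12 w02 k l
  · exact right 0 2 (by rw [hp, w12]) w11 w01 k l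
  · exact right 1 2 (by rw [hp, w02]) (by rw [hp, w01]) w00 k l

/-- The Schouten tensor `P_{ij} = R_{ij} - R g_{ij} / (2(n-1))`. -/
def schouten (g : SmoothMetric n M) (e : OpenPartialHomeomorph M (EuclideanSpace ℝ (Fin n))) :
    Comp n 2 := fun I x =>
  ricci g e I x - 1 / (2 * ((n : ℝ) - 1)) * (scal g e x * gLow g e (I 0) (I 1) x)

section Schouten

variable (g : SmoothMetric n M) {e : OpenPartialHomeomorph M (EuclideanSpace ℝ (Fin n))}

/-- The trace part of the Schouten tensor contributes twice to the product with `g`, and `2 /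
(2(n-1)(n-2))` is the coefficient of the scalar curvature term of `W`. -/
theorem weyl_eq (hn : 3 ≤ n) (e : OpenPartialHomeomorph M (EuclideanSpace ℝ (Fin n)))
    (I : Fin 4 → Fin n) (x : EuclideanSpace ℝ (Fin n)) :
    weyl g e I x = riemann g e I x - 1 / ((n : ℝ) - 2) * kulkarni g e (schouten g e) I x := by
  have hn' : (3 : ℝ) ≤ n := by exact_mod_cast hn
  have h1 : (n : ℝ) - 1 ≠ 0 := by linarith
  have h2 : (n : ℝ) - 2 ≠ 0 := by linarith
  simp only [weyl, kulkarni, schouten, Matrix.cons_val_zero, Matrix.cons_val_one]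
  field_simp
  ring

variable (he : e ∈ IsManifold.maximalAtlas (𝓡 n) ∞ M) {x : EuclideanSpace ℝ (Fin n)}
  (hx : x ∈ e.target)
include he

theorem contDiffOn_schouten (I : Fin 2 → Fin n) : ContDiffOn ℝ ∞ (schouten g e I) e.target :=
  (contDiffOn_ricci g he I).sub
    (contDiffOn_const.mul ((contDiffOn_scal g he).mul (contDiffOn_gLow g he _ _)))

theorem contDiffOn_kulkarni {T : Comp n 2} (hT : ∀ I, ContDiffOn ℝ ∞ (T I) e.target)
    (I : Fin 4 → Fin n) : ContDiffOn ℝ ∞ (kulkarni g e T I) e.target := by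
  have h : ∀ a b J, ContDiffOn ℝ ∞ (fun y => gLow g e a b y * T J y) e.target := fun a b J =>
    (contDiffOn_gLow g he a b).mul (hT J)
  exact (((h _ _ _).sub (h _ _ _)).sub (h _ _ _)).add (h _ _ _)

theorem contDiffOn_weyl (hn : 3 ≤ n) (I : Fin 4 → Fin n) :
    ContDiffOn ℝ ∞ (weyl g e I) e.target := by
  rw [show weyl g e I = _ from funext fun y => weyl_eq g hn e I y]
  exact (contDiffOn_riemann g he I).sub
    (contDiffOn_const.mul (contDiffOn_kulkarni g he (contDiffOn_schouten g he) I))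

theorem contDiffOn_cotton (I : Fin 3 → Fin n) : ContDiffOn ℝ ∞ (cotton g e I) e.target := by
  have h := contDiffOn_nabla g he (contDiffOn_ricci g he)
  have hs : ∀ i, ContDiffOn ℝ ∞ (dScal g e i) e.target := fun i =>
    contDiffOn_pd e.open_target (contDiffOn_scal g he) i
  exact ((h _).sub (h _)).sub (contDiffOn_const.mul
    (((contDiffOn_gLow g he _ _).mul (hs _)).sub ((contDiffOn_gLow g he _ _).mul (hs _))))

include hx

theorem schouten_symm (i j : Fin n) : schouten g e ![i, j] x = schouten g e ![j, i] x := by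
  simp only [schouten, Matrix.cons_val_zero, Matrix.cons_val_one, ricci_symm g he hx i j,
    gLow_symm g e i j]

theorem tr_schouten : (tr g e x fun i j => schouten g e ![i, j] x) =
    scal g e x - n / (2 * ((n : ℝ) - 1)) * scal g e x := by
  simp only [schouten, Matrix.cons_val_zero, Matrix.cons_val_one, tr_sub, tr_const_mul,
    tr_gLow g he hx, ← scal_eq_tr]
  ring

theorem nabla_schouten (m i j : Fin n) : nabla g e (schouten g e) ![m, i, j] x =
    nabla g e (ricci g e) ![m, i, j] x -
      1 / (2 * ((n : ℝ) - 1)) * (dScal g e m x * gLow g e i j x) := by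
  have hs : ∀ I : Fin 2 → Fin n,
      ContDiffOn ℝ ∞ (fun y => scal g e y * gLow g e (I 0) (I 1) y) e.target := fun I =>
    (contDiffOn_scal g he).mul (contDiffOn_gLow g he _ _)
  unfold schouten
  rw [nabla_sub g hx (contDiffOn_ricci g he) (S := fun I y =>
      1 / (2 * ((n : ℝ) - 1)) * (scal g e y * gLow g e (I 0) (I 1) y))
      fun I => contDiffOn_const.mul (hs I),
    nabla_const_mul g hx _ hs, nabla_mul_gLow g hx he (contDiffOn_scal g he)]
  rfl

/-- The scalar terms of `C` are those coming from the trace part of the Schouten tensor. -/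
theorem cotton_eq (i j k : Fin n) : cotton g e ![i, j, k] x =
    nabla g e (schouten g e) ![i, j, k] x - nabla g e (schouten g e) ![j, i, k] x := by
  rw [nabla_schouten g he hx, nabla_schouten g he hx]
  simp only [cotton, Matrix.cons_val_zero, Matrix.cons_val_one, Matrix.cons_val]
  ring

theorem cotton_antisymm (i j k : Fin n) : cotton g e ![i, j, k] x = -cotton g e ![j, i, k] x := by
  rw [cotton_eq g he hx, cotton_eq g he hx]
  ring

/-- The constant is `1/2 - 1/(2(n-1))`: the first term comes from the twice contracted Bianchi
identity, the second from the trace part. -/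
theorem tr_nabla_schouten (hn : 3 ≤ n) (j : Fin n) :
    (tr g e x fun l b => nabla g e (schouten g e) ![b, j, l] x) =
      ((n : ℝ) - 2) / (2 * ((n : ℝ) - 1)) * dScal g e j x := by
  have hn' : (3 : ℝ) ≤ n := by exact_mod_cast hn
  have h1 : (n : ℝ) - 1 ≠ 0 := by linarith
  have h : (tr g e x fun l b => nabla g e (ricci g e) ![b, j, l] x) = 1 / 2 * dScal g e j x := by
    rw [← tr_nabla_ricci g he hx]
    exact tr_congr g e x fun l b => nabla_ricci_symm g he hx _ _ _
  have h' : (tr g e x fun l b => dScal g e b x * gLow g e j l x) = dScal g e j x := by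
    rw [← tr_gLow_mul g he hx j fun b => dScal g e b x]
    exact tr_congr g e x fun l b => mul_comm _ _
  simp only [nabla_schouten g he hx, tr_sub, tr_const_mul, h, h']
  field_simp
  ring

/-- The Cotton tensor is totally trace-free. -/
theorem tr_cotton (hn : 3 ≤ n) (j : Fin n) :
    (tr g e x fun i k => cotton g e ![i, j, k] x) = 0 := by
  have hn' : (3 : ℝ) ≤ n := by exact_mod_cast hn
  have h1 : (n : ℝ) - 1 ≠ 0 := by linarith
  have h := tr_nabla_schouten g he hx hn j
  rw [tr_transpose] at h
  simp only [cotton_eq g he hx, tr_sub, h]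
  simp only [nabla_schouten g he hx, tr_sub, tr_const_mul, tr_gLow g he hx, ← dScal_eq_tr g he hx]
  field_simp
  ring

/-- The divergence of the Weyl tensor: `∇^l W_{ijkl} = -(n-3)/(n-2) C_{ijk}`. -/
theorem tr_nabla_weyl (hn : 3 ≤ n) (i j k : Fin n) :
    (tr g e x fun l b => nabla g e (weyl g e) ![b, i, j, k, l] x) =
      -(((n : ℝ) - 3) / ((n : ℝ) - 2)) * cotton g e ![i, j, k] x := by
  have hn' : (3 : ℝ) ≤ n := by exact_mod_cast hn
  have h1 : (n : ℝ) - 1 ≠ 0 := by linarith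
  have h2 : (n : ℝ) - 2 ≠ 0 := by linarith
  have hK := contDiffOn_kulkarni g he (contDiffOn_schouten g he)
  have hw : ∀ b l, nabla g e (weyl g e) ![b, i, j, k, l] x =
      nabla g e (riemann g e) ![b, i, j, k, l] x - 1 / ((n : ℝ) - 2) *
        (gLow g e i k x * nabla g e (schouten g e) ![b, j, l] x -
          gLow g e i l x * nabla g e (schouten g e) ![b, j, k] x -
          gLow g e j k x * nabla g e (schouten g e) ![b, i, l] x +
          gLow g e j l x * nabla g e (schouten g e) ![b, i, k] x) := by
    intro b l
    rw [nabla_congr g hx fun J y _ => weyl_eq g hn e J y,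
      nabla_sub g hx (contDiffOn_riemann g he)
        (S := fun J y => 1 / ((n : ℝ) - 2) * kulkarni g e (schouten g e) J y)
        fun J => contDiffOn_const.mul (hK J),
      nabla_const_mul g hx _ hK, nabla_kulkarni g hx he (contDiffOn_schouten g he)]
  -- The contracted Bianchi identity contracts the third slot of `Rm`, here it is the fourth, hence
  -- the sign.
  have hR : (tr g e x fun l b => nabla g e (riemann g e) ![b, i, j, k, l] x) =
      -(nabla g e (ricci g e) ![i, j, k] x - nabla g e (ricci g e) ![j, i, k] x) := by
    rw [← tr_nabla_riemann g he hx, ← tr_neg]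
    exact tr_congr g e x fun l b => nabla_riemann_antisymm_right g he hx _ _ _ _ _
  simp only [hw, tr_sub, tr_add, tr_const_mul, hR, tr_nabla_schouten g he hx hn]
  rw [tr_gLow_mul g he hx i fun b => nabla g e (schouten g e) ![b, j, k] x,
    tr_gLow_mul g he hx j fun b => nabla g e (schouten g e) ![b, i, k] x]
  simp only [nabla_schouten g he hx, cotton, Matrix.cons_val_zero, Matrix.cons_val_one,
    Matrix.cons_val]
  field_simp
  ring

theorem weyl_antisymm (hn : 3 ≤ n) (i j k l : Fin n) :
    weyl g e ![i, j, k, l] x = -weyl g e ![j, i, k, l] x := by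
  rw [weyl_eq g hn, weyl_eq g hn, riemann_antisymm]
  simp only [kulkarni, Matrix.cons_val_zero, Matrix.cons_val_one, Matrix.cons_val]
  ring

theorem weyl_antisymm_right (hn : 3 ≤ n) (i j k l : Fin n) :
    weyl g e ![i, j, k, l] x = -weyl g e ![i, j, l, k] x := by
  rw [weyl_eq g hn, weyl_eq g hn, riemann_antisymm_right g he hx]
  simp only [kulkarni, Matrix.cons_val_zero, Matrix.cons_val_one, Matrix.cons_val]
  ring

theorem weyl_pair_symm (hn : 3 ≤ n) (i j k l : Fin n) :
    weyl g e ![i, j, k, l] x = weyl g e ![k, l, i, j] x := by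
  rw [weyl_eq g hn, weyl_eq g hn, riemann_pair_symm g he hx]
  simp only [kulkarni, Matrix.cons_val_zero, Matrix.cons_val_one, Matrix.cons_val,
    gLow_symm g e k i, gLow_symm g e k j, gLow_symm g e l i, gLow_symm g e l j,
    schouten_symm g he hx k i, schouten_symm g he hx k j, schouten_symm g he hx l i,
    schouten_symm g he hx l j]
  ring

/-- The Weyl tensor is totally trace-free. -/
theorem tr_weyl (hn : 3 ≤ n) (j l : Fin n) :
    (tr g e x fun i k => weyl g e ![i, j, k, l] x) = 0 := by
  have hn' : (3 : ℝ) ≤ n := by exact_mod_cast hn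
  have h1 : (n : ℝ) - 1 ≠ 0 := by linarith
  have h2 : (n : ℝ) - 2 ≠ 0 := by linarith
  simp only [weyl_eq g hn, kulkarni, Matrix.cons_val_zero, Matrix.cons_val_one, Matrix.cons_val,
    tr_sub, tr_add, tr_const_mul, tr_mul_const, tr_gLow g he hx, tr_schouten g he hx,
    ← ricci_eq_tr]
  have h3 : (tr g e x fun i k => gLow g e j k x * schouten g e ![i, l] x) =
      schouten g e ![j, l] x := by
    rw [tr_transpose]
    exact tr_gLow_mul g he hx j fun i => schouten g e ![i, l] x
  rw [h3, tr_gLow_mul' g he hx l fun k => schouten g e ![j, k] x]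
  simp only [schouten, Matrix.cons_val_zero, Matrix.cons_val_one]
  rw [show gLow g e j l = gLow g e l j from funext fun y => gLow_symm g e j l y]
  field_simp
  ring

theorem weyl_eq_zero_of_dim_three (hn : n = 3) (i j k l : Fin n) :
    weyl g e ![i, j, k, l] x = 0 := by
  subst hn
  refine curvatureTensor_eq_zero_of_dim_three (W := fun i j k l => weyl g e ![i, j, k, l] x)
    (H := Matrix.of fun i j => gUp g e i j x) (weyl_antisymm g he hx le_rfl)
    (weyl_antisymm_right g he hx le_rfl) (weyl_pair_symm g he hx le_rfl)
    (fun i j => gUp_symm g e i j x) ?_ (fun j l => tr_weyl g he hx le_rfl j l) i j k l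
  have h : (Matrix.of fun i j => gUp g e i j x) * (Matrix.of fun i j => gLow g e i j x) = 1 := by
    ext i j
    simpa [Matrix.mul_apply, Matrix.one_apply] using sum_gUp_mul_gLow g he hx i j
  intro h0
  have := congrArg Matrix.det h
  rw [Matrix.det_mul, h0, zero_mul, Matrix.det_one] at this
  exact zero_ne_one this

/-- The connection curvature applied to a covector, as a metric contraction. -/
theorem sum_curv_mul (i j k : Fin n) (Z : Fin n → ℝ) : ∑ r, curv g e r i j k x * Z r =
    tr g e x fun p q => riemann g e ![i, j, p, k] x * Z q := by
  have h : ∀ r, Z r = tr g e x fun p q => gLow g e r p x * Z q := fun r =>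
    (tr_gLow_mul g he hx r Z).symm
  conv_lhs => enter [2, r]; rw [h r]
  rw [sum_mul_tr]
  refine tr_congr g e x fun p q => ?_
  rw [riemann_eq_sum_curv, Finset.sum_mul]
  exact Finset.sum_congr rfl fun r _ => by rw [gLow_symm g e r p]; ring

end Schouten

/-! ### The Bach tensor in terms of the Cotton and Weyl tensors -/

section Bach

variable (g : SmoothMetric n M) {e : OpenPartialHomeomorph M (EuclideanSpace ℝ (Fin n))}

theorem sum_eq_tr_tr (e : OpenPartialHomeomorph M (EuclideanSpace ℝ (Fin n)))
    (x : EuclideanSpace ℝ (Fin n)) (χ : Fin n → Fin n → Fin n → Fin n → ℝ) :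
    ∑ k, ∑ l, ∑ a, ∑ b, gUp g e k a x * gUp g e l b x * χ k l a b =
      tr g e x fun k a => tr g e x fun l b => χ k l a b := by
  simp only [tr, Finset.mul_sum, mul_assoc]
  exact Finset.sum_congr rfl fun k _ => Finset.sum_comm

theorem ricciNormSq_eq_tr (e : OpenPartialHomeomorph M (EuclideanSpace ℝ (Fin n)))
    (x : EuclideanSpace ℝ (Fin n)) : ricciNormSq g e x =
      tr g e x fun i k => tr g e x fun j l => ricci g e ![i, j] x * ricci g e ![k, l] x := by
  rw [← sum_eq_tr_tr]
  simp only [ricciNormSq, mul_assoc]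

variable (he : e ∈ IsManifold.maximalAtlas (𝓡 n) ∞ M) {x : EuclideanSpace ℝ (Fin n)}
  (hx : x ∈ e.target)
include he hx

theorem nabla_cotton_antisymm (m i j k : Fin n) :
    nabla g e (cotton g e) ![m, i, j, k] x = -nabla g e (cotton g e) ![m, j, i, k] x := by
  have hσ : ∀ J : Fin 3 → Fin n, J ∘ Equiv.swap 0 1 = ![J 1, J 0, J 2] := fun J => by
    ext a; fin_cases a <;> rfl
  have h := nabla_of_perm g hx (contDiffOn_cotton g he) (Equiv.swap 0 1) (-1)
    (fun J y hy => by
      rw [hσ, neg_one_mul, ← cotton_antisymm g he hy]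
      congr 1; ext a; fin_cases a <;> rfl) m ![i, j, k]
  rw [hσ, neg_one_mul] at h
  exact h

/-- The divergence formula for `W` is differentiated; the trace over the inner derivative index
commutes with the outer derivative. -/
theorem tr_nabla_nabla_weyl (hn : 3 ≤ n) (a i j k : Fin n) :
    (tr g e x fun l b => nabla g e (nabla g e (weyl g e)) ![a, b, i, j, k, l] x) =
      -(((n : ℝ) - 3) / ((n : ℝ) - 2)) * nabla g e (cotton g e) ![a, i, j, k] x := by
  rw [← nabla_tr_rank_five g hx he (contDiffOn_nabla g he (contDiffOn_weyl g he hn)),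
    ← nabla_const_mul g hx _ (contDiffOn_cotton g he)]
  refine nabla_congr g hx (fun J y hy => ?_) _
  rw [tr_nabla_weyl g he hy hn]
  congr 2
  ext a; fin_cases a <;> rfl

/-- `(n-2) B_{ij} = ∇^k C_{kij} + R^{kl} W_{ikjl}` in every dimension `n ≥ 3`. -/
theorem bach_eq (hn : 3 ≤ n) (i j : Fin n) : ((n : ℝ) - 2) * bach g e ![i, j] x =
    (tr g e x fun k a => nabla g e (cotton g e) ![a, k, i, j] x) +
      tr g e x fun k a => tr g e x fun l b =>
        ricci g e ![a, b] x * weyl g e ![i, k, j, l] x := by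
  have hn' : (3 : ℝ) ≤ n := by exact_mod_cast hn
  -- For `n = 3` the Weyl term is zero and `n - 2 = 1`. For `n ≥ 4` the factor `n - 3` from the
  -- divergence of `W` cancels the one in the definition.
  by_cases h3 : n = 3
  · have hW : ∀ k l, weyl g e ![i, k, j, l] x = 0 := fun k l =>
      weyl_eq_zero_of_dim_three g he hx h3 _ _ _ _
    have hr : (n : ℝ) - 2 = 1 := by rw [h3]; norm_num
    simp only [hW, mul_zero, tr_zero, add_zero, hr, one_mul, bach, if_pos h3]
    rfl
  · have h2 : (n : ℝ) - 2 ≠ 0 := by linarith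
    have h3' : (n : ℝ) - 3 ≠ 0 := sub_ne_zero.2 (by exact_mod_cast h3)
    simp only [bach, if_neg h3, mul_assoc (_ * _ : ℝ) (ricci g e _ x)]
    rw [sum_eq_tr_tr, sum_eq_tr_tr]
    simp only [Matrix.cons_val_zero, Matrix.cons_val_one, tr_nabla_nabla_weyl g he hx hn,
      tr_const_mul]
    rw [show (tr g e x fun k a => nabla g e (cotton g e) ![a, i, k, j] x) =
        -tr g e x fun k a => nabla g e (cotton g e) ![a, k, i, j] x from by
      rw [← tr_neg]; exact tr_congr g e x fun k a => nabla_cotton_antisymm g he hx _ _ _ _]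
    field_simp

end Bach

/-! ### Gradient Schouten solitons -/

/-- The differential of a function on `M` in a chart. -/
def dFun (g : SmoothMetric n M) (e : OpenPartialHomeomorph M (EuclideanSpace ℝ (Fin n)))
    (f : M → ℝ) : Comp n 1 :=
  nabla g e (k := 0) fun _ x => f (e.symm x)

theorem dFun_eq (g : SmoothMetric n M) (e : OpenPartialHomeomorph M (EuclideanSpace ℝ (Fin n)))
    (f : M → ℝ) (i : Fin n) (x : EuclideanSpace ℝ (Fin n)) :
    dFun g e f ![i] x = pd i (fun y => f (e.symm y)) x :=
  nabla_rank_zero g e x i _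

section Soliton

variable {g : SmoothMetric n M} {e : OpenPartialHomeomorph M (EuclideanSpace ℝ (Fin n))}
  (hn : 3 ≤ n) {f : M → ℝ} {lam : ℝ} (hsol : IsGradientSchoutenSoliton g f lam)
  (he : e ∈ IsManifold.maximalAtlas (𝓡 n) ∞ M) {x : EuclideanSpace ℝ (Fin n)} (hx : x ∈ e.target)
include hsol he

theorem contDiffOn_dFun (I : Fin 1 → Fin n) : ContDiffOn ℝ ∞ (dFun g e f I) e.target :=
  contDiffOn_nabla g he (fun _ => contDiffOn_comp_symm he hsol.1) I

include hx

theorem hess_eq (i j : Fin n) : hess g e f ![i, j] x =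
    (scal g e x / (2 * ((n : ℝ) - 1)) + lam) * gLow g e i j x - ricci g e ![i, j] x := by
  linarith [hsol.2 e he x hx i j]

/-- The coefficient `R/(2(n-1))` in the soliton equation is precisely the one in the Schouten
tensor, so the Hessian is a parallel tensor minus the Schouten tensor. -/
theorem nabla_hess (m i j : Fin n) : nabla g e (hess g e f) ![m, i, j] x =
    -nabla g e (schouten g e) ![m, i, j] x := by
  have h : ∀ J, ∀ y ∈ e.target, hess g e f J y =
      lam * gLow g e (J 0) (J 1) y - schouten g e J y := by
    intro J y hy
    have hJ : J = ![J 0, J 1] := by ext a; fin_cases a <;> rfl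
    conv_lhs => rw [hJ, hess_eq hsol he hy]
    rw [schouten, ← hJ]
    ring
  rw [nabla_congr g hx h, nabla_sub g hx (T := fun J y => lam * gLow g e (J 0) (J 1) y)
      (fun J => contDiffOn_const.mul (contDiffOn_gLow g he _ _)) (contDiffOn_schouten g he),
    nabla_mul_gLow g hx he contDiffOn_const, pd_const]
  ring

/-- For a gradient Schouten soliton, `C_{ijk} = -R_{ijkl} ∇^l f`. -/
theorem cotton_eq_tr (i j k : Fin n) : cotton g e ![i, j, k] x =
    -tr g e x fun p q => riemann g e ![i, j, k, p] x * dFun g e f ![q] x := by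
  have h := ricci_identity g he hx (contDiffOn_dFun hsol he) i j ![k]
  have u : ∀ r, Function.update ![k] 0 r = ![r] := fun r => by ext a; fin_cases a; rfl
  simp only [Fin.sum_univ_one, u, Matrix.cons_val_zero] at h
  rw [sum_curv_mul g he hx i j k fun r => dFun g e f ![r] x] at h
  have h1 := nabla_hess hsol he hx i j k
  have h2 := nabla_hess hsol he hx j i k
  have h3 : nabla g e (hess g e f) ![i, j, k] x - nabla g e (hess g e f) ![j, i, k] x = _ := h
  have h4 : (tr g e x fun p q => riemann g e ![i, j, p, k] x * dFun g e f ![q] x) =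
      -tr g e x fun p q => riemann g e ![i, j, k, p] x * dFun g e f ![q] x := by
    rw [← tr_neg]
    exact tr_congr g e x fun p q => by rw [riemann_antisymm_right g he hx]; ring
  rw [cotton_eq g he hx]
  linarith

include hn

/-- For a gradient Schouten soliton, `Ric(∇f) = 0`. -/
theorem tr_ricci_mul_dFun (j : Fin n) :
    (tr g e x fun p q => ricci g e ![j, p] x * dFun g e f ![q] x) = 0 := by
  -- The trace of the formula for `C` over its first and third indices contracts `Rm` to `Ric`,
  -- while the trace of `C` is zero.
  have h := tr_cotton g he hx hn j
  simp only [cotton_eq_tr hsol he hx, tr_neg] at h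
  rw [tr_comm] at h
  simp only [tr_mul_const, ← ricci_eq_tr] at h
  linarith

theorem tr_ricci_mul_dFun' (j : Fin n) :
    (tr g e x fun p q => ricci g e ![p, j] x * dFun g e f ![q] x) = 0 := by
  rw [← tr_ricci_mul_dFun hn hsol he hx j]
  exact tr_congr g e x fun p q => by rw [ricci_symm g he hx]

/-- The covariant derivative of the identity `Ric(∇f) = 0`. -/
theorem tr_nabla_ricci_mul_dFun (m j : Fin n) :
    (tr g e x fun p q => nabla g e (ricci g e) ![m, j, p] x * dFun g e f ![q] x) =
      -tr g e x fun p q => ricci g e ![j, p] x * hess g e f ![m, q] x := by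
  have h := nabla_tr_two_one g hx he (contDiffOn_ricci g he) (contDiffOn_dFun hsol he) m j
  rw [nabla_congr g hx (S := fun _ _ => 0) fun J y hy =>
    tr_ricci_mul_dFun hn hsol he hy (J 0), tr_add] at h
  have h0 : nabla g e (fun (_ : Fin 1 → Fin n) _ => 0) ![m, j] x = 0 := by
    simp [nabla_rank_one, pd_const]
  rw [h0] at h
  have h1 : (tr g e x fun p q => ricci g e ![j, p] x * nabla g e (dFun g e f) ![m, q] x) =
    tr g e x fun p q => ricci g e ![j, p] x * hess g e f ![m, q] x := rfl
  linarith

omit hn in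
theorem nabla_cotton (m i j k : Fin n) : nabla g e (cotton g e) ![m, i, j, k] x =
    -tr g e x fun p q => nabla g e (riemann g e) ![m, i, j, k, p] x * dFun g e f ![q] x +
      riemann g e ![i, j, k, p] x * hess g e f ![m, q] x := by
  have h := nabla_tr_four_one g hx he (contDiffOn_riemann g he) (contDiffOn_dFun hsol he) m i j k
  have hc : ∀ J, ∀ y ∈ e.target, cotton g e J y = (-1) * tr g e y fun p q =>
      riemann g e ![J 0, J 1, J 2, p] y * dFun g e f ![q] y := by
    intro J y hy
    rw [neg_one_mul, ← cotton_eq_tr hsol he hy]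
    congr 1; ext a; fin_cases a <;> rfl
  rw [nabla_congr g hx hc, nabla_const_mul g hx _ fun J => contDiffOn_tr g he fun p q =>
    (contDiffOn_riemann g he _).mul (contDiffOn_dFun hsol he _), h, neg_one_mul]
  rfl

omit hn in
theorem tr_mul_hess (v : Fin n → ℝ) (m : Fin n) :
    (tr g e x fun p q => v p * hess g e f ![m, q] x) =
      (scal g e x / (2 * ((n : ℝ) - 1)) + lam) * v m -
        tr g e x fun p q => v p * ricci g e ![m, q] x := by
  simp only [hess_eq hsol he hx, mul_sub, tr_sub]
  rw [← tr_mul_gLow g he hx m v, ← tr_const_mul]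
  congr 1
  exact tr_congr g e x fun p q => by ring

/-- The divergence of the Cotton tensor of a gradient Schouten soliton. -/
theorem tr_nabla_cotton (i j : Fin n) :
    (tr g e x fun k a => nabla g e (cotton g e) ![a, k, i, j] x) =
      (tr g e x fun p q => ricci g e ![i, p] x * hess g e f ![j, q] x) +
      (tr g e x fun p q => nabla g e (ricci g e) ![p, j, i] x * dFun g e f ![q] x) +
      (scal g e x / (2 * ((n : ℝ) - 1)) + lam) * ricci g e ![i, j] x +
      tr g e x fun k a => tr g e x fun p q =>
        riemann g e ![k, i, j, p] x * ricci g e ![a, q] x := by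
  simp only [nabla_cotton hsol he hx, tr_neg, tr_add]
  rw [tr_comm]
  -- Pair symmetry moves the divergence index to the third slot, where the contracted Bianchi
  -- identity applies.
  have h1 : ∀ p q, (tr g e x fun k a =>
      nabla g e (riemann g e) ![a, k, i, j, p] x * dFun g e f ![q] x) =
      nabla g e (ricci g e) ![j, i, p] x * dFun g e f ![q] x -
        nabla g e (ricci g e) ![p, j, i] x * dFun g e f ![q] x := by
    intro p q
    rw [tr_mul_const, ← sub_mul, nabla_ricci_symm g he hx j, ← tr_nabla_riemann g he hx]
    congr 1
    exact tr_congr g e x fun k a => nabla_riemann_pair_symm g he hx _ _ _ _ _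
  have h2 : ∀ k a, (tr g e x fun p q => riemann g e ![k, i, j, p] x * hess g e f ![a, q] x) = _ :=
    fun k a => tr_mul_hess hsol he hx (fun p => riemann g e ![k, i, j, p] x) a
  have h3 : (tr g e x fun k a => riemann g e ![k, i, j, a] x) = -ricci g e ![i, j] x := by
    rw [ricci_eq_tr, ← tr_neg]
    exact tr_congr g e x fun k a => riemann_antisymm_right g he hx _ _ _ _
  simp only [h1, h2, tr_sub, tr_const_mul, h3, tr_nabla_ricci_mul_dFun hn hsol he hx]
  ring

/-- The divergence of the Cotton tensor contracted with the gradient. -/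
theorem tr_tr_nabla_cotton_mul_dFun (j : Fin n) :
    (tr g e x fun i c => (tr g e x fun k a => nabla g e (cotton g e) ![a, k, i, j] x) *
      dFun g e f ![c] x) =
    tr g e x fun i c => (tr g e x fun k a => tr g e x fun p q =>
        riemann g e ![k, i, j, p] x * ricci g e ![a, q] x) * dFun g e f ![c] x := by
  simp only [tr_nabla_cotton hn hsol he hx, add_mul, tr_add]
  have h0 := tr_ricci_mul_dFun hn hsol he hx
  have h1 : (tr g e x fun i c => (tr g e x fun p q =>
      ricci g e ![i, p] x * hess g e f ![j, q] x) * dFun g e f ![c] x) = 0 := by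
    simp only [← tr_mul_const]
    rw [tr_comm]
    have : ∀ p q, (tr g e x fun i c => ricci g e ![i, p] x * hess g e f ![j, q] x *
        dFun g e f ![c] x) = 0 := by
      intro p q
      rw [← zero_mul (hess g e f ![j, q] x), ← tr_ricci_mul_dFun' hn hsol he hx p, ← tr_mul_const]
      exact tr_congr g e x fun i c => by ring
    simp only [this, tr_zero]
  -- By the differentiated identity this becomes `-Ric_{ji} ∇^i ∇^p f ∇_p f`. The soliton equation
  -- and `Ric(∇f) = 0` make `∇∇f(∇f, ·)` a multiple of `df`, so `Ric(∇f) = 0` applies again.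
  have h2 : (tr g e x fun i c => (tr g e x fun p q =>
      nabla g e (ricci g e) ![p, j, i] x * dFun g e f ![q] x) * dFun g e f ![c] x) = 0 := by
    simp only [← tr_mul_const]
    rw [tr_comm]
    have hd : ∀ p q, (tr g e x fun i c => nabla g e (ricci g e) ![p, j, i] x * dFun g e f ![q] x *
        dFun g e f ![c] x) = -(tr g e x fun i c =>
          ricci g e ![j, i] x * hess g e f ![p, c] x * dFun g e f ![q] x) := by
      intro p q
      rw [tr_mul_const, ← neg_mul, ← tr_nabla_ricci_mul_dFun hn hsol he hx, ← tr_mul_const]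
      exact tr_congr g e x fun i c => by ring
    simp only [hd, tr_neg]
    rw [tr_comm]
    have hz : ∀ i c, (tr g e x fun p q =>
        ricci g e ![j, i] x * hess g e f ![p, c] x * dFun g e f ![q] x) =
        (scal g e x / (2 * ((n : ℝ) - 1)) + lam) *
          (ricci g e ![j, i] x * dFun g e f ![c] x) := by
      intro i c
      have := tr_ricci_mul_dFun' hn hsol he hx c
      have hg := tr_gLow_mul' g he hx c fun q => dFun g e f ![q] x
      simp only [mul_assoc, tr_const_mul, hess_eq hsol he hx, sub_mul, tr_sub, this, hg]
      ring
    simp only [hz, tr_const_mul, h0]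
    ring
  rw [h1, h2]
  simp only [mul_assoc, tr_const_mul, tr_ricci_mul_dFun' hn hsol he hx]
  ring

/-- As `Ric(∇f) = 0`, only the trace part of the Schouten tensor acts on the gradient. -/
theorem tr_schouten_mul_dFun (k : Fin n) :
    (tr g e x fun i c => schouten g e ![i, k] x * dFun g e f ![c] x) =
      -(scal g e x / (2 * ((n : ℝ) - 1))) * dFun g e f ![k] x := by
  have hg := tr_gLow_mul' g he hx k fun q => dFun g e f ![q] x
  simp only [schouten, sub_mul, tr_sub, tr_ricci_mul_dFun' hn hsol he hx, mul_assoc,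
    tr_const_mul, Matrix.cons_val_zero, Matrix.cons_val_one, hg]
  ring

/-- The Weyl term of the Bach tensor contracted with the gradient. -/
theorem tr_tr_ricci_mul_weyl_mul_dFun (j : Fin n) :
    (tr g e x fun i c => (tr g e x fun k a => tr g e x fun l b =>
      ricci g e ![a, b] x * weyl g e ![i, k, j, l] x) * dFun g e f ![c] x) =
    -(tr g e x fun i c => (tr g e x fun k a => tr g e x fun p q =>
        riemann g e ![k, i, j, p] x * ricci g e ![a, q] x) * dFun g e f ![c] x) -
      1 / ((n : ℝ) - 2) * (ricciNormSq g e x - scal g e x ^ 2 / ((n : ℝ) - 1)) *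
        dFun g e f ![j] x := by
  have hn' : (3 : ℝ) ≤ n := by exact_mod_cast hn
  have n1 : (n : ℝ) - 1 ≠ 0 := by linarith
  have n2 : (n : ℝ) - 2 ≠ 0 := by linarith
  have hP := tr_schouten_mul_dFun hn hsol he hx
  have hg : ∀ k, (tr g e x fun i c => gLow g e i k x * dFun g e f ![c] x) = dFun g e f ![k] x :=
    fun k => tr_gLow_mul' g he hx k fun q => dFun g e f ![q] x
  have hK : ∀ k l, (tr g e x fun i c =>
      kulkarni g e (schouten g e) ![i, k, j, l] x * dFun g e f ![c] x) =
      dFun g e f ![j] x * schouten g e ![k, l] x - dFun g e f ![l] x * schouten g e ![k, j] x +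
      scal g e x / (2 * ((n : ℝ) - 1)) * (gLow g e k j x * dFun g e f ![l] x) -
      scal g e x / (2 * ((n : ℝ) - 1)) * (dFun g e f ![j] x * gLow g e k l x) := by
    intro k l
    have e1 : ∀ i c, kulkarni g e (schouten g e) ![i, k, j, l] x * dFun g e f ![c] x =
        gLow g e i j x * dFun g e f ![c] x * schouten g e ![k, l] x -
        gLow g e i l x * dFun g e f ![c] x * schouten g e ![k, j] x -
        schouten g e ![i, l] x * dFun g e f ![c] x * gLow g e k j x +
        schouten g e ![i, j] x * dFun g e f ![c] x * gLow g e k l x := by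
      intro i c
      simp only [kulkarni, Matrix.cons_val_zero, Matrix.cons_val_one, Matrix.cons_val]
      ring
    simp only [e1, tr_add, tr_sub, tr_mul_const, hg, hP]
    ring
  have hRic : ∀ a k, (tr g e x fun l b => gLow g e k l x * ricci g e ![a, b] x) =
      ricci g e ![a, k] x := fun a k => tr_gLow_mul g he hx k fun b => ricci g e ![a, b] x
  have hscal : (tr g e x fun k a => ricci g e ![a, k] x) = scal g e x := by
    rw [scal_eq_tr, tr_transpose]
  have hRg : (tr g e x fun k a => tr g e x fun l b => ricci g e ![a, b] x *
      (scal g e x / (2 * ((n : ℝ) - 1)) * (dFun g e f ![j] x * gLow g e k l x))) =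
      scal g e x ^ 2 / (2 * ((n : ℝ) - 1)) * dFun g e f ![j] x := by
    have h : ∀ k a l b, ricci g e ![a, b] x *
        (scal g e x / (2 * ((n : ℝ) - 1)) * (dFun g e f ![j] x * gLow g e k l x)) =
        scal g e x / (2 * ((n : ℝ) - 1)) * dFun g e f ![j] x *
          (gLow g e k l x * ricci g e ![a, b] x) := fun k a l b => by ring
    simp only [h, tr_const_mul, hRic, hscal]
    ring
  have hRP : (tr g e x fun k a => tr g e x fun l b =>
      ricci g e ![a, b] x * (dFun g e f ![j] x * schouten g e ![k, l] x)) =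
      (ricciNormSq g e x - scal g e x ^ 2 / (2 * ((n : ℝ) - 1))) * dFun g e f ![j] x := by
    have h : ∀ k a l b, ricci g e ![a, b] x * (dFun g e f ![j] x * schouten g e ![k, l] x) =
        dFun g e f ![j] x * (ricci g e ![k, l] x * ricci g e ![a, b] x) - ricci g e ![a, b] x *
          (scal g e x / (2 * ((n : ℝ) - 1)) * (dFun g e f ![j] x * gLow g e k l x)) := by
      intro k a l b
      simp only [schouten, Matrix.cons_val_zero, Matrix.cons_val_one]
      ring
    simp only [h, tr_sub]
    rw [hRg]
    simp only [tr_const_mul, ← ricciNormSq_eq_tr]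
    ring
  have hz1 : (tr g e x fun k a => tr g e x fun l b =>
      ricci g e ![a, b] x * (dFun g e f ![l] x * schouten g e ![k, j] x)) = 0 := by
    have h : ∀ k a l b, ricci g e ![a, b] x * (dFun g e f ![l] x * schouten g e ![k, j] x) =
        schouten g e ![k, j] x * (ricci g e ![a, b] x * dFun g e f ![l] x) :=
      fun k a l b => by ring
    have h' : ∀ a, (tr g e x fun l b => ricci g e ![a, b] x * dFun g e f ![l] x) = 0 := by
      intro a
      rw [tr_transpose]
      exact tr_ricci_mul_dFun hn hsol he hx a
    simp only [h, tr_const_mul, h', mul_zero, tr_zero]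
  have hz2 : (tr g e x fun k a => tr g e x fun l b =>
      ricci g e ![a, b] x * (scal g e x / (2 * ((n : ℝ) - 1)) *
        (gLow g e k j x * dFun g e f ![l] x))) = 0 := by
    have h : ∀ k a l b, ricci g e ![a, b] x * (scal g e x / (2 * ((n : ℝ) - 1)) *
        (gLow g e k j x * dFun g e f ![l] x)) = scal g e x / (2 * ((n : ℝ) - 1)) *
        gLow g e k j x * (ricci g e ![a, b] x * dFun g e f ![l] x) :=
      fun k a l b => by ring
    have h' : ∀ a, (tr g e x fun l b => ricci g e ![a, b] x * dFun g e f ![l] x) = 0 := by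
      intro a
      rw [tr_transpose]
      exact tr_ricci_mul_dFun hn hsol he hx a
    simp only [h, tr_const_mul, h', mul_zero, tr_zero]
  -- Of the four terms in `hK`, the two carrying `∇_l f` die against `Ric`. The other two give
  -- `|Ric|² - R²/(2(n-1))` and `-R²/(2(n-1))`.
  have hKK : (tr g e x fun i c => (tr g e x fun k a => tr g e x fun l b =>
      ricci g e ![a, b] x * kulkarni g e (schouten g e) ![i, k, j, l] x) * dFun g e f ![c] x) =
      (ricciNormSq g e x - scal g e x ^ 2 / ((n : ℝ) - 1)) * dFun g e f ![j] x := by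
    simp only [← tr_mul_const]
    rw [tr_comm]
    have h : ∀ k a, (tr g e x fun i c => tr g e x fun l b => ricci g e ![a, b] x *
        kulkarni g e (schouten g e) ![i, k, j, l] x * dFun g e f ![c] x) =
        tr g e x fun l b => ricci g e ![a, b] x * tr g e x fun i c =>
          kulkarni g e (schouten g e) ![i, k, j, l] x * dFun g e f ![c] x := by
      intro k a
      rw [tr_comm]
      simp only [mul_assoc, tr_const_mul]
    simp only [h, hK, mul_sub (ricci g e _ x), mul_add (ricci g e _ x), tr_sub, tr_add]
    rw [hRP, hRg, hz1, hz2]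
    field_simp
    ring
  -- This is the contribution that cancels against the divergence of the Cotton tensor.
  have hR : (tr g e x fun i c => (tr g e x fun k a => tr g e x fun l b =>
      ricci g e ![a, b] x * riemann g e ![i, k, j, l] x) * dFun g e f ![c] x) =
      -(tr g e x fun i c => (tr g e x fun k a => tr g e x fun p q =>
        riemann g e ![k, i, j, p] x * ricci g e ![a, q] x) * dFun g e f ![c] x) := by
    simp only [← tr_neg, ← neg_mul]
    refine tr_congr g e x fun i c => congrArg (· * _) <| tr_congr g e x fun k a =>
      tr_congr g e x fun l b => ?_
    rw [riemann_antisymm g e i k]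
    ring
  have e1 : ∀ a b i k l, ricci g e ![a, b] x * weyl g e ![i, k, j, l] x =
      ricci g e ![a, b] x * riemann g e ![i, k, j, l] x - 1 / ((n : ℝ) - 2) *
        (ricci g e ![a, b] x * kulkarni g e (schouten g e) ![i, k, j, l] x) := by
    intro a b i k l
    rw [weyl_eq g hn]
    ring
  simp only [e1, tr_sub, tr_const_mul, sub_mul, mul_assoc (1 / ((n : ℝ) - 2)), hR, hKK]

/-- For a gradient Schouten soliton, `B(∇f, ·)` is a multiple of `df`. -/
theorem tr_bach_mul_dFun (j : Fin n) :
    (tr g e x fun i c => bach g e ![i, j] x * dFun g e f ![c] x) =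
      (scal g e x ^ 2 - ((n : ℝ) - 1) * ricciNormSq g e x) /
          (((n : ℝ) - 1) * ((n : ℝ) - 2) ^ 2) * dFun g e f ![j] x := by
  have hn' : (3 : ℝ) ≤ n := by exact_mod_cast hn
  have n1 : (n : ℝ) - 1 ≠ 0 := by linarith
  have n2 : (n : ℝ) - 2 ≠ 0 := by linarith
  have h : ((n : ℝ) - 2) * (tr g e x fun i c => bach g e ![i, j] x * dFun g e f ![c] x) =
      -(1 / ((n : ℝ) - 2) * (ricciNormSq g e x - scal g e x ^ 2 / ((n : ℝ) - 1)) *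
        dFun g e f ![j] x) := by
    simp only [← tr_const_mul, ← mul_assoc, bach_eq g he hx hn, add_mul, tr_add]
    rw [tr_tr_nabla_cotton_mul_dFun hn hsol he hx, tr_tr_ricci_mul_weyl_mul_dFun hn hsol he hx]
    ring
  rw [← mul_right_inj' n2, h]
  field_simp
  ring

end Soliton

/-! ### The divergence of the Bach tensor in dimension three -/

section DimensionThree

variable {g : SmoothMetric n M} {e : OpenPartialHomeomorph M (EuclideanSpace ℝ (Fin n))}
  (hn : n = 3) {f : M → ℝ} {lam : ℝ} (hsol : IsGradientSchoutenSoliton g f lam)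
  (he : e ∈ IsManifold.maximalAtlas (𝓡 n) ∞ M) {x : EuclideanSpace ℝ (Fin n)} (hx : x ∈ e.target)
include hn he hx

theorem divBach_eq_tr_tr (j : Fin n) : divBach g e ![j] x =
    tr g e x fun i k => tr g e x fun a b =>
      nabla g e (nabla g e (cotton g e)) ![k, b, a, i, j] x := by
  have hb : bach g e = fun J y => tr g e y fun a b => nabla g e (cotton g e) ![b, a, J 0, J 1] y := by
    funext J y
    simp only [bach, if_pos hn]
    rfl
  change (tr g e x fun i k => nabla g e (bach g e) ![k, i, j] x) = _
  rw [hb]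
  exact tr_congr g e x fun i k =>
    nabla_tr_rank_four' g hx he (contDiffOn_nabla g he (contDiffOn_cotton g he)) k i j

/-- In dimension three, the divergence of the Bach tensor is a contraction of the curvature with
the Cotton tensor. -/
theorem two_mul_divBach (j : Fin n) : 2 * divBach g e ![j] x =
    -tr g e x fun i k => tr g e x fun a b => tr g e x fun p q =>
      riemann g e ![k, b, p, j] x * cotton g e ![a, i, q] x := by
  have hσ : ∀ J : Fin 4 → Fin n, J ∘ Equiv.swap 1 2 = ![J 0, J 2, J 1, J 3] := fun J => by
    ext a; fin_cases a <;> rfl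
  have hanti : ∀ k b a i, nabla g e (nabla g e (cotton g e)) ![k, b, a, i, j] x =
      -nabla g e (nabla g e (cotton g e)) ![k, b, i, a, j] x := by
    intro k b a i
    have h := nabla_of_perm g hx (contDiffOn_nabla g he (contDiffOn_cotton g he))
      (Equiv.swap 1 2) (-1) (fun J y hy => by
        rw [hσ, neg_one_mul, ← nabla_cotton_antisymm g he hy]
        congr 1; ext a; fin_cases a <;> rfl) k ![b, a, i, j]
    rw [hσ, neg_one_mul] at h
    exact h
  -- Interchanging the two contractions and using antisymmetry of `C` in its first two indices shows
  -- that exchanging the derivatives changes the sign; hence `2 div B` is a commutator.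
  have hswap : divBach g e ![j] x = -tr g e x fun i k => tr g e x fun a b =>
      nabla g e (nabla g e (cotton g e)) ![b, k, a, i, j] x := by
    rw [divBach_eq_tr_tr hn he hx]
    rw [tr_comm, ← tr_neg]
    refine tr_congr g e x fun i k => ?_
    rw [← tr_neg]
    exact tr_congr g e x fun a b => hanti _ _ _ _
  have hcomm : ∀ i k a b, nabla g e (nabla g e (cotton g e)) ![k, b, a, i, j] x -
      nabla g e (nabla g e (cotton g e)) ![b, k, a, i, j] x =
      -((tr g e x fun p q => riemann g e ![k, b, p, a] x * cotton g e ![q, i, j] x) +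
        (tr g e x fun p q => riemann g e ![k, b, p, i] x * cotton g e ![a, q, j] x) +
        tr g e x fun p q => riemann g e ![k, b, p, j] x * cotton g e ![a, i, q] x) := by
    intro i k a b
    have h := ricci_identity g he hx (contDiffOn_cotton g he) k b ![a, i, j]
    have u0 : ∀ r, Function.update ![a, i, j] 0 r = ![r, i, j] := fun r => by
      ext a; fin_cases a <;> rfl
    have u1 : ∀ r, Function.update ![a, i, j] 1 r = ![a, r, j] := fun r => by
      ext a; fin_cases a <;> rfl
    have u2 : ∀ r, Function.update ![a, i, j] 2 r = ![a, i, r] := fun r => by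
      ext a; fin_cases a <;> rfl
    simp only [Fin.sum_univ_three, u0, u1, u2, Matrix.cons_val_zero, Matrix.cons_val_one,
      Matrix.cons_val] at h
    rw [sum_curv_mul g he hx k b a fun r => cotton g e ![r, i, j] x,
      sum_curv_mul g he hx k b i fun r => cotton g e ![a, r, j] x,
      sum_curv_mul g he hx k b j fun r => cotton g e ![a, i, r] x] at h
    exact h
  -- In this term and the next, `Rm` contracts to `Ric` up to sign, and symmetric `Ric` meets
  -- antisymmetric `C`. Only the term acting on the free index `j` survives.
  have h1 : (tr g e x fun i k => tr g e x fun a b => tr g e x fun p q =>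
      riemann g e ![k, b, p, a] x * cotton g e ![q, i, j] x) = 0 := by
    have hric : ∀ k p, (tr g e x fun a b => riemann g e ![k, b, p, a] x) = ricci g e ![k, p] x := by
      intro k p
      rw [ricci_eq_tr, tr_transpose]
      exact tr_congr g e x fun a b => by
        rw [riemann_antisymm, riemann_antisymm_right g he hx, neg_neg]
    have : ∀ i k, (tr g e x fun a b => tr g e x fun p q =>
        riemann g e ![k, b, p, a] x * cotton g e ![q, i, j] x) = tr g e x fun p q =>
          ricci g e ![k, p] x * cotton g e ![q, i, j] x := by
      intro i k
      rw [tr_comm]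
      simp only [tr_mul_const, hric]
    simp only [this]
    rw [tr_transpose]
    exact tr_tr_symm_mul_antisymm g e x (fun k p => ricci g e ![k, p] x)
      (fun i q => cotton g e ![q, i, j] x) (fun _ _ => ricci_symm g he hx _ _)
      fun _ _ => cotton_antisymm g he hx _ _ _
  have h2 : (tr g e x fun i k => tr g e x fun a b => tr g e x fun p q =>
      riemann g e ![k, b, p, i] x * cotton g e ![a, q, j] x) = 0 := by
    have hric : ∀ b p, (tr g e x fun i k => riemann g e ![k, b, p, i] x) = -ricci g e ![b, p] x := by
      intro b p
      rw [ricci_eq_tr, tr_transpose, ← tr_neg]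
      exact tr_congr g e x fun a b => riemann_antisymm_right g he hx _ _ _ _
    have : ∀ a b, (tr g e x fun i k => tr g e x fun p q =>
        riemann g e ![k, b, p, i] x * cotton g e ![a, q, j] x) = -tr g e x fun p q =>
          ricci g e ![b, p] x * cotton g e ![a, q, j] x := by
      intro a b
      rw [tr_comm]
      simp only [tr_mul_const, hric, neg_mul, tr_neg]
    rw [tr_comm]
    simp only [this, tr_neg]
    rw [tr_transpose, neg_eq_zero]
    exact tr_tr_symm_mul_antisymm g e x (fun k p => ricci g e ![k, p] x)
      (fun a q => cotton g e ![a, q, j] x) (fun _ _ => ricci_symm g he hx _ _)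
      fun _ _ => cotton_antisymm g he hx _ _ _
  have h3 : divBach g e ![j] x + divBach g e ![j] x = tr g e x fun i k => tr g e x fun a b =>
      (nabla g e (nabla g e (cotton g e)) ![k, b, a, i, j] x -
        nabla g e (nabla g e (cotton g e)) ![b, k, a, i, j] x) := by
    simp only [tr_sub]
    conv_lhs => rw [hswap]
    rw [← divBach_eq_tr_tr hn he hx, hswap]
    ring
  rw [two_mul, h3]
  simp only [hcomm, tr_neg, tr_add]
  rw [h1, h2]
  ring

include hsol

/-- Here `W = 0` gives `Rm = g ∧ P`, inserted in `C = -Rm(∇f)`. The coefficient `R/2` is `R/4` from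
`P` plus `R/4` from its action on `∇f`. -/
theorem cotton_eq_of_dim_three (i j k : Fin n) : cotton g e ![i, j, k] x =
    dFun g e f ![i] x * (ricci g e ![j, k] x - scal g e x / 2 * gLow g e j k x) -
      dFun g e f ![j] x * (ricci g e ![i, k] x - scal g e x / 2 * gLow g e i k x) := by
  have h3 : 3 ≤ n := hn.ge
  have hr : (n : ℝ) = 3 := by rw [hn]; norm_num
  have hR : ∀ p, riemann g e ![i, j, k, p] x = kulkarni g e (schouten g e) ![i, j, k, p] x := by
    intro p
    have h := weyl_eq g h3 e ![i, j, k, p] x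
    rw [weyl_eq_zero_of_dim_three g he hx hn, hr] at h
    linarith
  have hP' : ∀ j, (tr g e x fun p q => schouten g e ![j, p] x * dFun g e f ![q] x) =
      -(scal g e x / 4) * dFun g e f ![j] x := by
    intro j
    rw [show scal g e x / 4 = scal g e x / (2 * ((n : ℝ) - 1)) by rw [hr]; norm_num,
      ← tr_schouten_mul_dFun h3 hsol he hx]
    exact tr_congr g e x fun p q => by rw [schouten_symm g he hx]
  have hg : ∀ i, (tr g e x fun p q => gLow g e i p x * dFun g e f ![q] x) = dFun g e f ![i] x :=
    fun i => tr_gLow_mul g he hx i fun q => dFun g e f ![q] x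
  have e1 : ∀ p q, riemann g e ![i, j, k, p] x * dFun g e f ![q] x =
      gLow g e i k x * (schouten g e ![j, p] x * dFun g e f ![q] x) -
      schouten g e ![j, k] x * (gLow g e i p x * dFun g e f ![q] x) -
      gLow g e j k x * (schouten g e ![i, p] x * dFun g e f ![q] x) +
      schouten g e ![i, k] x * (gLow g e j p x * dFun g e f ![q] x) := by
    intro p q
    rw [hR]
    simp only [kulkarni, Matrix.cons_val_zero, Matrix.cons_val_one, Matrix.cons_val]
    ring
  rw [cotton_eq_tr hsol he hx]
  simp only [e1, tr_add, tr_sub, tr_const_mul, hP', hg]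
  simp only [schouten, Matrix.cons_val_zero, Matrix.cons_val_one, hr]
  ring

/-- In dimension three, `div B = B(∇f, ·)` for a gradient Schouten soliton. -/
theorem divBach_eq_tr_bach_mul_dFun (j : Fin n) : divBach g e ![j] x =
    tr g e x fun i c => bach g e ![i, j] x * dFun g e f ![c] x := by
  have h3 : 3 ≤ n := hn.ge
  have hb : (tr g e x fun i c => bach g e ![i, j] x * dFun g e f ![c] x) =
      tr g e x fun i k => tr g e x fun a b => tr g e x fun p q =>
        riemann g e ![k, b, p, j] x * ricci g e ![a, q] x * dFun g e f ![i] x := by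
    rw [show bach g e = fun J y => tr g e y fun a b => nabla g e (cotton g e) ![b, a, J 0, J 1] y by
      funext J y
      simp only [bach, if_pos hn]
      rfl]
    simp only [Matrix.cons_val_zero, Matrix.cons_val_one]
    rw [tr_tr_nabla_cotton_mul_dFun h3 hsol he hx, tr_transpose]
    refine tr_congr g e x fun i k => ?_
    rw [tr_transpose, ← tr_mul_const]
    refine tr_congr g e x fun a b => ?_
    rw [← tr_mul_const]
    refine tr_congr g e x fun p q => ?_
    rw [riemann_antisymm g e b k, riemann_antisymm_right g he hx k b j, neg_neg]
  -- Contracting with the metric turns `Rm` into `Ric`, which annihilates the gradient; so the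
  -- scalar curvature terms of `C` drop out.
  have hg : (tr g e x fun i k => tr g e x fun a b => tr g e x fun p q =>
        riemann g e ![k, b, p, j] x * gLow g e a q x * dFun g e f ![i] x) = 0 := by
    have h1 : ∀ i k a b, (tr g e x fun p q =>
        riemann g e ![k, b, p, j] x * gLow g e a q x * dFun g e f ![i] x) =
        riemann g e ![k, b, a, j] x * dFun g e f ![i] x := by
      intro i k a b
      rw [tr_mul_const, tr_mul_gLow g he hx a fun p => riemann g e ![k, b, p, j] x]
    have h2 : ∀ k, (tr g e x fun a b => riemann g e ![k, b, a, j] x) = -ricci g e ![k, j] x := by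
      intro k
      rw [ricci_eq_tr, tr_transpose, ← tr_neg]
      exact tr_congr g e x fun a b => riemann_antisymm g e _ _ _ _ x
    simp only [h1, tr_mul_const, h2, neg_mul, tr_neg]
    rw [tr_transpose, tr_ricci_mul_dFun' h3 hsol he hx, neg_zero]
  -- The two halves of `C` differ by exchanging `a` and `i`. Exchanging the contracted pairs costs a
  -- sign from antisymmetry of `Rm`, so the halves add up and both equal `B(∇f, ·)` up to the same
  -- sign.
  have hY : ∀ Q : Fin n → Fin n → ℝ, (tr g e x fun i k => tr g e x fun a b => tr g e x fun p q =>
        riemann g e ![k, b, p, j] x * Q i q * dFun g e f ![a] x) =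
      -tr g e x fun i k => tr g e x fun a b => tr g e x fun p q =>
        riemann g e ![k, b, p, j] x * Q a q * dFun g e f ![i] x := by
    intro Q
    rw [tr_comm]
    simp only [← tr_neg]
    refine tr_congr g e x fun i k => tr_congr g e x fun a b => tr_congr g e x fun p q => ?_
    rw [riemann_antisymm g e b k]
    ring
  have hd := two_mul_divBach (g := g) hn he hx j
  have e1 : ∀ i k a b p q, riemann g e ![k, b, p, j] x * cotton g e ![a, i, q] x =
      (riemann g e ![k, b, p, j] x * ricci g e ![i, q] x * dFun g e f ![a] x -
        scal g e x / 2 * (riemann g e ![k, b, p, j] x * gLow g e i q x * dFun g e f ![a] x)) -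
      (riemann g e ![k, b, p, j] x * ricci g e ![a, q] x * dFun g e f ![i] x -
        scal g e x / 2 * (riemann g e ![k, b, p, j] x * gLow g e a q x * dFun g e f ![i] x)) := by
    intro i k a b p q
    rw [cotton_eq_of_dim_three hn hsol he hx]
    ring
  simp only [e1, tr_sub, tr_const_mul] at hd
  rw [hY fun i q => ricci g e ![i, q] x, hY fun i q => gLow g e i q x, hg, ← hb] at hd
  linarith

end DimensionThree

/-! ### Evaluation on tangent vectors -/

section Evaluation

variable (g : SmoothMetric n M) {e : OpenPartialHomeomorph M (EuclideanSpace ℝ (Fin n))}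
  (he : e ∈ IsManifold.maximalAtlas (𝓡 n) ∞ M) {x : EuclideanSpace ℝ (Fin n)}
  (hx : x ∈ e.target) {f : M → ℝ} (hf : ContMDiff (𝓡 n) 𝓘(ℝ, ℝ) ∞ f)
include he hx hf

theorem sum_gLow_mul_coord_grad (j : Fin n) :
    ∑ i, gLow g e i j x * coord e (e.symm x) (grad g f (e.symm x)) i = dFun g e f ![j] x := by
  rw [dFun_eq, ← mfderiv_coordField he hx hf, ← inner_grad g f (e.symm x) (coordField e j x)]
  conv_rhs => rw [symm_coord he hx (grad g f (e.symm x))]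
  rw [map_sum, sum_apply]
  refine Finset.sum_congr rfl fun i _ => ?_
  rw [map_smul, smul_apply, smul_eq_mul, mul_comm]
  rfl

theorem coord_grad (i : Fin n) : coord e (e.symm x) (grad g f (e.symm x)) i =
    ∑ a, gUp g e i a x * dFun g e f ![a] x := by
  simp only [← sum_gLow_mul_coord_grad g he hx hf, Finset.mul_sum]
  rw [Finset.sum_comm]
  have h : ∀ b, ∑ a, gUp g e i a x * (gLow g e b a x * coord e (e.symm x) (grad g f (e.symm x)) b) =
      (if i = b then 1 else 0) * coord e (e.symm x) (grad g f (e.symm x)) b := by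
    intro b
    rw [← sum_gUp_mul_gLow g he hx i b, Finset.sum_mul]
    exact Finset.sum_congr rfl fun a _ => by rw [gLow_symm g e b a, mul_assoc]
  rw [Finset.sum_congr rfl fun b _ => h b]
  simp

theorem inner_grad_eq_sum (X : TangentSpace (𝓡 n) (e.symm x)) :
    g.inner (e.symm x) (grad g f (e.symm x)) X =
      ∑ j, dFun g e f ![j] x * coord e (e.symm x) X j := by
  rw [inner_grad, mfderiv_eq_sum he hx hf]
  exact Finset.sum_congr rfl fun j _ => by rw [dFun_eq, mul_comm]

/-- The components of the gradient are those of `df` raised by the inverse metric, so evaluation on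
it is a trace against `df`. This links the invariant statement to the index identities. -/
theorem eval₂_grad (T : Comp n 2) (X : TangentSpace (𝓡 n) (e.symm x)) :
    eval₂ e T (e.symm x) (grad g f (e.symm x)) X =
      ∑ j, (tr g e x fun i a => T ![i, j] x * dFun g e f ![a] x) * coord e (e.symm x) X j := by
  rw [eval₂, e.right_inv hx, Finset.sum_comm]
  refine Finset.sum_congr rfl fun j _ => ?_
  rw [← Finset.sum_mul]
  congr 1
  refine Finset.sum_congr rfl fun i _ => ?_
  rw [coord_grad g he hx hf, Finset.mul_sum]
  exact Finset.sum_congr rfl fun a _ => by ring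

end Evaluation

end

end Riem


/-- At a regular point `p` of the potential function, in every smooth chart `e` around `p`. -/
theorem proposition4p1 {n : ℕ} (hn : 3 ≤ n) {M : Type*} [TopologicalSpace M]
    [ChartedSpace (EuclideanSpace ℝ (Fin n)) M] [IsManifold (𝓡 n) ∞ M]
    (g : SmoothMetric n M) (f : M → ℝ) (lam : ℝ)
    (hsol : Riem.IsGradientSchoutenSoliton g f lam)
    (e : OpenPartialHomeomorph M (EuclideanSpace ℝ (Fin n)))
    (he : e ∈ IsManifold.maximalAtlas (𝓡 n) ∞ M)
    (p : M) (hp : p ∈ e.source)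
    (hreg : mfderiv (𝓡 n) 𝓘(ℝ, ℝ) f p ≠ 0) :
    (∀ X : TangentSpace (𝓡 n) p,
      Riem.eval₂ e (Riem.bach g e) p (Riem.grad g f p) X =
        (Riem.scal g e (e p) ^ 2 - ((n : ℝ) - 1) * Riem.ricciNormSq g e (e p)) /
          (((n : ℝ) - 1) * ((n : ℝ) - 2) ^ 2) * g.inner p (Riem.grad g f p) X) ∧
    (n = 3 → ∀ X : TangentSpace (𝓡 n) p,
      Riem.eval₁ e (Riem.divBach g e) p X =
        (Riem.scal g e (e p) ^ 2 - 2 * Riem.ricciNormSq g e (e p)) / 2 *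
          g.inner p (Riem.grad g f p) X) := by
  -- The coordinate lemmas live at `e.symm x`; substituting for `p` makes the tangent spaces agree
  -- definitionally.
  obtain ⟨x, hx, rfl⟩ : ∃ x ∈ e.target, p = e.symm x :=
    ⟨e p, e.map_source hp, (e.left_inv hp).symm⟩
  rw [e.right_inv hx]
  refine ⟨fun X => ?_, fun h3 X => ?_⟩
  · rw [Riem.eval₂_grad g he hx hsol.1, Riem.inner_grad_eq_sum g he hx hsol.1, Finset.mul_sum]
    exact Finset.sum_congr rfl fun j _ => by
      rw [Riem.tr_bach_mul_dFun hn hsol he hx, mul_assoc]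
  · rw [Riem.eval₁, e.right_inv hx, Riem.inner_grad_eq_sum g he hx hsol.1, Finset.mul_sum]
    refine Finset.sum_congr rfl fun j _ => ?_
    rw [Riem.divBach_eq_tr_bach_mul_dFun h3 hsol he hx, Riem.tr_bach_mul_dFun hn hsol he hx]
    have hr : (n : ℝ) = 3 := by rw [h3]; norm_num
    rw [hr]
    ring
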